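/- Let $A=(a_{ij})_{i,j=1}^{\ell}$ be a symmetrizable generalized Cartan matrix with realization $(\mathfrak h,\{\alpha_i\},\{\alpha_i^\vee\})$, and let $\mathfrak g=\mathfrak g(A)$ be its Kac--Moody algebra over $\mathbb C$, i.e. the Lie algebra generated by $\mathfrak h$ and $e_i,f_i$ with the Chevalley--Serre relations. Let $\Delta$ be its set of roots, $\Delta^{\pm}$ the sets of positive and negative roots, $\mathfrak g_\alpha$ ($\alpha\in\Delta\cup\{0\}$) the root spaces, and $Q^+=\sum_i\mathbb Z_{\ge 0}\alpha_i$. Let $P\subseteq\mathfrak h^*$ be a restricted weight lattice: a subgroup that contains all $\alpha_i$, takes integer values on all $\alpha_i^\vee$, and has a $\mathbb Z$-basis $\omega_1,\dots,\omega_{\dim\mathfrak h}$ that is also a $\mathbb C$-basis of $\mathfrak h^*$ and satisfies $\langle\omega_i,\alpha_j^\vee\rangle=\delta_{ij}$ for $i,j\le \ell$. Let $\rho:\mathfrak g\to\mathfrak{gl}(V)$ be a weight module (the direct sum of its weight spaces $V_\mu$, all finite-dimensional) with set of weights $\mathrm{wts}(V)\subseteq P$, and let $f:P\to\mathbb Z$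 be $\mathbb Z$-linear. Put $\Delta_k=\{\alpha\in\Delta\cup\{0\}: f(\alpha)=k\}$ and $\mathrm{wts}_k(V)=\{\mu\in\mathrm{wts}(V): f(\mu)=k\}$ for $k\in\mathbb Z$. Assume that $V$ is a standard graded module with grading function $f$: all $\Delta_k$ and $\mathrm{wts}_k(V)$ are finite, $\Delta_k\subseteq\Delta^+$ for $k>0$, $\Delta_0=\{0\}$, $\Delta_k\subseteq\Delta^-$ for $k<0$, and distinct $\mu,\nu\in\mathrm{wts}_k(V)$ never satisfy $\nu-\mu\in Q^+$. Set $\mathfrak g_k=\bigoplus_{\alpha\in\Delta_k}\mathfrak g_\alpha$ and $V_k=\bigoplus_{\mu\in\mathrm{wts}_k(V)}V_\mu$. Let $$\widehat{\mathfrak g}=\bigoplus_{k<0}\mathfrak g_k\oplus\prod_{k\ge0}\mathfrak g_k,\qquad \widehat V=\bigoplus_{k<0}V_k\oplus\prod_{k\ge0}V_k,\qquad \widehat{\mathfrak n}^+_n=\prod_{k\ge n}\mathfrak g_k ,$$ and extend $\rho$ to $\widehat{\mathfrak g}$ acting on $\widehat V$ by $(\rho(x)v)_k=\sum_i x_i\cdot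 v_{k-i}$. For $x\in\widehat{\mathfrak n}^+_1$ let $\exp(\rho(x))=\sum_{r\ge0}\rho(x)^r/r!\in\mathrm{GL}(\widehat V)$; in each coordinate, applied to a vector, this is a finite sum. For $n\ge1$ put $$\widehat U^+_{V,n}=\Big\{\prod_{k=n}^{\infty}\exp(\rho(x_k)) : x_k\in\mathfrak g_k\Big\}\subseteq\mathrm{GL}(\widehat V),\qquad \prod_{k=n}^{\infty}\exp(\rho(x_k)):=\lim_{N\to\infty}\exp(\rho(x_N))\cdots\exp(\rho(x_n)),$$ where the limit is taken coordinatewise on each vector of $\widehat V$. Then for all positive integers $n$ and $m$: 1. $\widehat U^+_{V,n}=\exp(\rho(\widehat{\mathfrak n}^+_n))$. 2. $\exp(\rho(x))\,\widehat U^+_{V,n+1}=\exp(\rho(x+\widehat{\mathfrak n}^+_{n+1}))$ for $x\in\mathfrak g_n$. 3. $\exp(\rho(x+y))\,\widehat U^+_{V,n+1}=\exp(\rho(x))\exp(\rho(y))\,\widehat U^+_{V,n+1}$ for $x,y\in\mathfrak g_n$. 4. $\exp(\rho([x,y]))\,\widehat U^+_{V,n+m+1}=\big(\exp(\rho(x)),\exp(\rho(y))\big)\,\widehat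 U^+_{V,n+m+1}$ for $x\in\mathfrak g_n$, $y\in\mathfrak g_m$, where $(a,b)=aba^{-1}b^{-1}$. 5. $\widehat U^+_{V,n}$ and $\widehat U^+_{V,n+1}$ are subgroups of $\mathrm{GL}(\widehat V)$, with $\widehat U^+_{V,n+1}$ contained and normal in $\widehat U^+_{V,n}$, and $\exp\circ\rho$ induces a surjective group homomorphism from the additive group $\widehat{\mathfrak n}^+_n/\widehat{\mathfrak n}^+_{n+1}$ to $\widehat U^+_{V,n}/\widehat U^+_{V,n+1}$. If $V$ is a faithful $\mathfrak g$-module, this homomorphism is an isomorphism. -/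

import Mathlib

noncomputable section

open Module

namespace KM

/-! ### Graded completions and pro-summable series -/

section Completion

variable {M : Type*} [AddCommGroup M] [Module ℂ M] (W : ℤ → Submodule ℂ M)

/-- The positive completion `⨁_{m < 0} W m ⊕ ∏_{m ≥ 0} W m`, realized as the space of families
`(v_m)_{m ∈ ℤ}` with `v_m ∈ W m` and `v_m = 0` for all sufficiently negative `m`. -/
def Completion : Submodule ℂ (ℤ → M) where
  carrier := {v | (∀ m, v m ∈ W m) ∧ ∃ N : ℤ, ∀ m < N, v m = 0}
  add_mem' := by
    rintro a b ⟨ha, N, hN⟩ ⟨hb, N', hN'⟩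
    refine ⟨fun m => (W m).add_mem (ha m) (hb m), min N N', fun m hm => ?_⟩
    simp [hN m (lt_of_lt_of_le hm (min_le_left _ _)), hN' m (lt_of_lt_of_le hm (min_le_right _ _))]
  zero_mem' := ⟨fun m => (W m).zero_mem, 0, fun _ _ => rfl⟩
  smul_mem' := by
    rintro c a ⟨ha, N, hN⟩
    exact ⟨fun m => (W m).smul_mem c (ha m), N, fun m hm => by simp [hN m hm]⟩

/-- The subspace `∏_{j ≥ k} W j` of the completion. -/
def tail (k : ℤ) : Submodule ℂ (Completion W) where
  carrier := {v | ∀ j < k, (v : ℤ → M) j = 0}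
  add_mem' := by
    intro a b ha hb j hj
    simp [ha j hj, hb j hj]
  zero_mem' := fun _ _ => rfl
  smul_mem' := by
    intro c a ha j hj
    simp [ha j hj]

variable {W}

theorem mem_tail {k : ℤ} {v : Completion W} : v ∈ tail W k ↔ ∀ j < k, (v : ℤ → M) j = 0 := Iff.rfl

theorem exists_mem_tail (v : Completion W) : ∃ k, v ∈ tail W k := v.2.2

theorem tail_mono {j k : ℤ} (h : j ≤ k) : tail W k ≤ tail W j :=
  fun _ hv i hi => hv i (lt_of_lt_of_le hi h)

/-- A family of operators preserving all `tail W k` is pro-summable if it induces a summable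
family on each quotient by `tail W k`, i.e. if, for each vector, only finitely many operators
contribute in each degree. -/
structure ProSummable {J : Type*} (θ : J → End ℂ (Completion W)) : Prop where
  preserves : ∀ j k, ∀ v ∈ tail W k, θ j v ∈ tail W k
  finite : ∀ v k, {j | ((θ j v : Completion W) : ℤ → M) k ≠ 0}.Finite

/-- The sum of a pro-summable family, computed degree by degree by finite sums. -/
def proSum {J : Type*} (θ : J → End ℂ (Completion W)) (h : ProSummable θ) :
    End ℂ (Completion W) where
  toFun v := ⟨fun k => ∑ᶠ j, ((θ j v : Completion W) : ℤ → M) k, by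
    refine ⟨fun k => ?_, ?_⟩
    · refine finsum_induction (p := fun y => y ∈ W k) (W k).zero_mem
        (fun _ _ => (W k).add_mem) (fun j => (θ j v).2.1 k)
    · obtain ⟨N, hN⟩ := exists_mem_tail v
      refine ⟨N, fun m hm => ?_⟩
      exact (finsum_congr fun j => h.preserves j N v hN m hm).trans finsum_zero⟩
  map_add' v w := by
    ext k
    simp only [map_add, Submodule.coe_add, Pi.add_apply]
    exact finsum_add_distrib (h.finite v k) (h.finite w k)
  map_smul' c v := by
    ext k
    simp only [map_smul, Submodule.coe_smul, Pi.smul_apply, RingHom.id_apply]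
    exact (smul_finsum' c (h.finite v k)).symm

theorem proSum_apply {J : Type*} (θ : J → End ℂ (Completion W)) (h : ProSummable θ)
    (v : Completion W) (k : ℤ) :
    ((proSum θ h v : Completion W) : ℤ → M) k = ∑ᶠ j, ((θ j v : Completion W) : ℤ → M) k := rfl

/-- `T` raises degrees by at least `d`. -/
def RaisesBy (d : ℤ) (T : End ℂ (Completion W)) : Prop :=
  ∀ k, ∀ v ∈ tail W k, T v ∈ tail W (k + d)

theorem RaisesBy.pow {T : End ℂ (Completion W)} {d : ℤ} (hT : RaisesBy d T) (n : ℕ) :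
    RaisesBy (n * d) (T ^ n) := by
  induction n with
  | zero => intro k v hv; simpa using hv
  | succ n ih =>
    intro k v hv
    rw [pow_succ', Module.End.mul_apply]
    have := hT _ _ (ih k v hv)
    convert this using 2
    push_cast
    ring

theorem RaisesBy.proSummable {T : End ℂ (Completion W)} {d : ℤ} (hd : 1 ≤ d)
    (hT : RaisesBy d T) (c : ℕ → ℂ) : ProSummable fun n : ℕ => c n • T ^ n where
  preserves n k v hv := by
    refine (tail W k).smul_mem _ (tail_mono ?_ (hT.pow n k v hv))
    have : 0 ≤ (n : ℤ) * d := by positivity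
    linarith
  finite v k := by
    obtain ⟨N, hN⟩ := exists_mem_tail v
    refine (Set.finite_lt_nat ((k - N + 1).toNat)).subset fun n hn => ?_
    by_contra hlt
    have hlt' : (k - N + 1).toNat ≤ n := not_lt.mp hlt
    apply hn
    have h1 : (n : ℤ) ≤ (n : ℤ) * d := le_mul_of_one_le_right (by positivity) hd
    have : (T ^ n) v ∈ tail W (k + 1) := tail_mono (by omega) (hT.pow n N v hN)
    simp [this k (by omega)]

/-- The exponential series `∑ Tⁿ / n!` of a degree-raising operator. -/
def expEnd {d : ℤ} (hd : 1 ≤ d) (T : End ℂ (Completion W)) (hT : RaisesBy d T) :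
    End ℂ (Completion W) :=
  proSum (fun n : ℕ => ((n.factorial : ℂ)⁻¹) • T ^ n) (hT.proSummable hd _)

theorem expEnd_sub_one {d e : ℤ} (hd : 1 ≤ d) (he : 1 ≤ e) (T : End ℂ (Completion W))
    (hT : RaisesBy d T) (hT' : RaisesBy e T) : RaisesBy e (expEnd hd T hT - 1) := by
  intro k v hv j hj
  have key : ∀ n : ℕ, n ≠ 0 →
      ((((n.factorial : ℂ)⁻¹ • T ^ n) v : Completion W) : ℤ → M) j = 0 := by
    intro n hn
    have h1 : e ≤ (n : ℤ) * e := le_mul_of_one_le_left (by omega) (by omega)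
    have := (hT'.pow n k v hv) j (by omega)
    simp [this]
  have := proSum_apply (fun n : ℕ => ((n.factorial : ℂ)⁻¹) • T ^ n) (hT.proSummable hd _) v j
  rw [finsum_eq_single _ 0 key] at this
  simp [expEnd, this]

/-- An operator that is the identity plus a degree-raising operator is invertible. -/
theorem isUnit_of_sub_one {U : End ℂ (Completion W)} (hU : RaisesBy 1 (U - 1)) : IsUnit U := by
  rw [Module.End.isUnit_iff]
  constructor
  · rw [injective_iff_map_eq_zero]
    intro v hv
    obtain ⟨N, hN⟩ := exists_mem_tail v
    have step : ∀ n : ℕ, v ∈ tail W (N + n) := by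
      intro n
      induction n with
      | zero => simpa using hN
      | succ n ih =>
        have := hU _ _ ih
        rw [LinearMap.sub_apply, hv, zero_sub, Module.End.one_apply, Submodule.neg_mem_iff] at this
        simpa [add_assoc] using this
    ext k
    exact step (k - N + 1).toNat k (by omega)
  · intro v
    have hR : RaisesBy 1 (1 - U) := by
      intro k w hw
      have := (tail W (k + 1)).neg_mem (hU k w hw)
      simpa using this
    let c : ℕ → ℂ := fun _ => 1
    let G := proSum (fun n : ℕ => c n • (1 - U) ^ n) (hR.proSummable le_rfl c)
    refine ⟨G v, ?_⟩
    ext k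
    obtain ⟨N, hN⟩ := exists_mem_tail v
    -- approximate the series by a partial sum
    let K := (k - N + 1).toNat
    let s : Completion W := ∑ n ∈ Finset.range K, ((1 - U) ^ n) v
    have hs : G v - s ∈ tail W (k + 1) := by
      intro j hj
      have h1 : ((G v : Completion W) : ℤ → M) j
          = ∑ n ∈ Finset.range K, ((((1 - U) ^ n) v : Completion W) : ℤ → M) j := by
        rw [show ((G v : Completion W) : ℤ → M) j = _ from proSum_apply _ _ v j,
          finsum_eq_sum_of_support_subset (s := Finset.range K)]
        · simp [c]
        · intro n hn
          by_contra hlt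
          have hlt' : K ≤ n := by simpa using hlt
          apply hn
          have : ((1 - U) ^ n) v ∈ tail W (k + 1) :=
            tail_mono (by omega) (hR.pow n N v hN)
          simp [c, this j hj]
      simp [h1, s]
    have h2 : U (G v - s) ∈ tail W (k + 1) := by
      have := (tail W (k + 1)).sub_mem hs (tail_mono (by omega) (hR _ _ hs))
      simpa using this
    have h3 : U s = v - ((1 - U) ^ K) v := by
      have hg : U * ∑ n ∈ Finset.range K, (1 - U) ^ n = 1 - (1 - U) ^ K := by
        have := mul_neg_geom_sum (1 - U) K
        have hU' : 1 - (1 - U) = U := by ext; simp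
        rwa [hU'] at this
      have := congrArg (fun T : End ℂ (Completion W) => T v) hg
      simpa [s, LinearMap.sum_apply] using this
    have h4 : ((1 - U) ^ K) v ∈ tail W (k + 1) := tail_mono (by omega) (hR.pow K N v hN)
    have h5 : U (G v) - v ∈ tail W (k + 1) := by
      have : U (G v) - v = U (G v - s) - ((1 - U) ^ K) v := by
        rw [map_sub, h3]; abel
      rw [this]
      exact Submodule.sub_mem _ h2 h4
    have := h5 k (by omega)
    simpa [sub_eq_zero] using this

/-- The limit of a sequence of operators whose coordinates stabilize. -/
def coordLimit (S : ℕ → End ℂ (Completion W))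
    (hp : ∀ N k, ∀ v ∈ tail W k, S N v ∈ tail W k)
    (hS : ∀ v k, ∃ w, ∀ᶠ N in Filter.atTop, ((S N v : Completion W) : ℤ → M) k = w) :
    End ℂ (Completion W) where
  toFun v := ⟨fun k => (hS v k).choose, by
    refine ⟨fun k => ?_, ?_⟩
    · obtain ⟨N, hN⟩ := (hS v k).choose_spec.exists
      have := (S N v).2.1 k
      rwa [hN] at this
    · obtain ⟨K, hK⟩ := exists_mem_tail v
      refine ⟨K, fun m hm => ?_⟩
      obtain ⟨N, hN⟩ := (hS v m).choose_spec.exists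
      exact hN.symm.trans (hp N K v hK m hm)⟩
  map_add' v w := by
    ext k
    obtain ⟨N, h1, h2, h3⟩ := ((hS (v + w) k).choose_spec.and
      ((hS v k).choose_spec.and (hS w k).choose_spec)).exists
    simp only [Submodule.coe_add, Pi.add_apply]
    rw [← h1, ← h2, ← h3]
    simp
  map_smul' c v := by
    ext k
    obtain ⟨N, h1, h2⟩ := ((hS (c • v) k).choose_spec.and (hS v k).choose_spec).exists
    simp only [Submodule.coe_smul, Pi.smul_apply, RingHom.id_apply]
    rw [← h1, ← h2]
    simp

theorem coordLimit_eventually (S : ℕ → End ℂ (Completion W))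
    (hp : ∀ N k, ∀ v ∈ tail W k, S N v ∈ tail W k)
    (hS : ∀ v k, ∃ w, ∀ᶠ N in Filter.atTop, ((S N v : Completion W) : ℤ → M) k = w)
    (v : Completion W) (k : ℤ) :
    ∀ᶠ N in Filter.atTop, ((S N v : Completion W) : ℤ → M) k
      = ((coordLimit S hp hS v : Completion W) : ℤ → M) k :=
  (hS v k).choose_spec

end Completion

/-! ### Kac–Moody algebras -/

section Algebra

variable {ℓ : ℕ}

structure IsGeneralizedCartan (A : Matrix (Fin ℓ) (Fin ℓ) ℤ) : Prop where
  diag : ∀ i, A i i = 2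
  nonpos : ∀ i j, i ≠ j → A i j ≤ 0
  zero : ∀ i j, A i j = 0 → A j i = 0

def IsSymmetrizable (A : Matrix (Fin ℓ) (Fin ℓ) ℤ) : Prop :=
  ∃ d : Fin ℓ → ℚ, (∀ i, 0 < d i) ∧
    (Matrix.diagonal d * A.map (fun a => (a : ℚ))).IsSymm

/-- A realization `(𝔥, Π, Π^∨)` of `A`. -/
structure Realization (A : Matrix (Fin ℓ) (Fin ℓ) ℤ) (𝔥 : Type*)
    [AddCommGroup 𝔥] [Module ℂ 𝔥] where
  finite : FiniteDimensional ℂ 𝔥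
  finrank_add_rank : finrank ℂ 𝔥 + (A.map (fun a => (a : ℂ))).rank = 2 * ℓ
  root : Fin ℓ → Dual ℂ 𝔥
  coroot : Fin ℓ → 𝔥
  linearIndependent_root : LinearIndependent ℂ root
  linearIndependent_coroot : LinearIndependent ℂ coroot
  root_coroot : ∀ i j, root j (coroot i) = (A i j : ℂ)

/-- Generators of the Kac–Moody algebra. -/
inductive Gen (ℓ : ℕ) (𝔥 : Type*)
  | h : 𝔥 → Gen ℓ 𝔥
  | e : Fin ℓ → Gen ℓ 𝔥
  | f : Fin ℓ → Gen ℓ 𝔥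

variable {A : Matrix (Fin ℓ) (Fin ℓ) ℤ} {𝔥 : Type*} [AddCommGroup 𝔥] [Module ℂ 𝔥]

namespace Realization

variable (ℓ) in
/-- The generator `h` of the free Lie algebra, for `h ∈ 𝔥`. -/
abbrev frH (h : 𝔥) : FreeLieAlgebra ℂ (Gen ℓ 𝔥) := FreeLieAlgebra.of ℂ (Gen.h h)

variable (𝔥) in
/-- The generator `e_i` of the free Lie algebra. -/
abbrev frE (i : Fin ℓ) : FreeLieAlgebra ℂ (Gen ℓ 𝔥) := FreeLieAlgebra.of ℂ (Gen.e i)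

variable (𝔥) in
/-- The generator `f_i` of the free Lie algebra. -/
abbrev frF (i : Fin ℓ) : FreeLieAlgebra ℂ (Gen ℓ 𝔥) := FreeLieAlgebra.of ℂ (Gen.f i)

/-- The elements of the free Lie algebra which are set to zero. The first two families say that
`𝔥` embeds linearly, the others are the usual Chevalley–Serre relations. -/
inductive Rel (R : Realization A 𝔥) : FreeLieAlgebra ℂ (Gen ℓ 𝔥) → Prop
  | add (h h' : 𝔥) : Rel R (frH ℓ (h + h') - (frH ℓ h + frH ℓ h'))
  | smul (c : ℂ) (h : 𝔥) : Rel R (frH ℓ (c • h) - c • frH ℓ h)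
  | hh (h h' : 𝔥) : Rel R ⁅frH ℓ h, frH ℓ h'⁆
  | he (h : 𝔥) (i : Fin ℓ) : Rel R (⁅frH ℓ h, frE 𝔥 i⁆ - R.root i h • frE 𝔥 i)
  | hf (h : 𝔥) (i : Fin ℓ) : Rel R (⁅frH ℓ h, frF 𝔥 i⁆ + R.root i h • frF 𝔥 i)
  | ef (i : Fin ℓ) : Rel R (⁅frE 𝔥 i, frF 𝔥 i⁆ - frH ℓ (R.coroot i))
  | ef_ne (i j : Fin ℓ) (hij : i ≠ j) : Rel R ⁅frE 𝔥 i, frF 𝔥 j⁆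
  | serre_e (i j : Fin ℓ) (hij : i ≠ j) :
      Rel R (((LieAlgebra.ad ℂ _ (frE 𝔥 i)) ^ (1 - A i j).toNat) (frE 𝔥 j))
  | serre_f (i j : Fin ℓ) (hij : i ≠ j) :
      Rel R (((LieAlgebra.ad ℂ _ (frF 𝔥 i)) ^ (1 - A i j).toNat) (frF 𝔥 j))

/-- The ideal generated by the relations. -/
def relIdeal (R : Realization A 𝔥) : LieIdeal ℂ (FreeLieAlgebra ℂ (Gen ℓ 𝔥)) :=
  LieSubmodule.lieSpan ℂ _ {x | Rel R x}

/-- The Kac–Moody algebra `𝔤(A)` of a realization, by generators and relations. -/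
def KacMoody (R : Realization A 𝔥) : Type _ :=
  FreeLieAlgebra ℂ (Gen ℓ 𝔥) ⧸ R.relIdeal

instance (R : Realization A 𝔥) : LieRing R.KacMoody :=
  inferInstanceAs (LieRing (FreeLieAlgebra ℂ (Gen ℓ 𝔥) ⧸ R.relIdeal))

instance (R : Realization A 𝔥) : LieAlgebra ℂ R.KacMoody :=
  inferInstanceAs (LieAlgebra ℂ (FreeLieAlgebra ℂ (Gen ℓ 𝔥) ⧸ R.relIdeal))

variable (R : Realization A 𝔥)

/-- The image in `𝔤(A)` of an element of `𝔥`. -/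
def cartan (h : 𝔥) : R.KacMoody :=
  LieSubmodule.Quotient.mk (N := R.relIdeal) (frH ℓ h)

section Weights

variable (M : Type*) [AddCommGroup M] [Module ℂ M] [LieRingModule R.KacMoody M]
  [LieModule ℂ R.KacMoody M]

/-- The weight space `M_μ`; for `M = 𝔤` the root space `𝔤_μ`. -/
def weightSpace (μ : Dual ℂ 𝔥) : Submodule ℂ M where
  carrier := {v | ∀ h : 𝔥, ⁅R.cartan h, v⁆ = μ h • v}
  add_mem' := by
    intro a b ha hb h
    rw [lie_add, ha h, hb h, smul_add]
  zero_mem' := by simp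
  smul_mem' := by
    intro c a ha h
    rw [lie_smul, ha h, smul_comm]

def wts : Set (Dual ℂ 𝔥) := {μ | R.weightSpace M μ ≠ ⊥}

open Classical in
/-- A weight module: the direct sum of its weight spaces, all of finite dimension. -/
structure IsWeightModule : Prop where
  isInternal : DirectSum.IsInternal (fun μ : Dual ℂ 𝔥 => R.weightSpace M μ)
  finite : ∀ μ, FiniteDimensional ℂ (R.weightSpace M μ)

end Weights

/-- The set `Δ` of roots. -/
def roots : Set (Dual ℂ 𝔥) := {α | α ≠ 0 ∧ R.weightSpace R.KacMoody α ≠ ⊥}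

/-- The monoid `Q⁺` of nonnegative integral combinations of simple roots. -/
def Qplus : Set (Dual ℂ 𝔥) := {μ | ∃ k : Fin ℓ → ℕ, μ = ∑ i, k i • R.root i}

def posRoots : Set (Dual ℂ 𝔥) := {α | α ∈ R.roots ∧ α ∈ R.Qplus}

def negRoots : Set (Dual ℂ 𝔥) := {α | α ∈ R.roots ∧ -α ∈ R.Qplus}

/-- A restricted weight lattice: it contains the root lattice, is integral on the simple coroots,
and some set of fundamental weights (which are dual to the simple coroots) extends to a family
which is both a `ℤ`-basis of `P` and a `ℂ`-basis of `𝔥*`. -/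
structure IsRestrictedWeightLattice (P : AddSubgroup (Dual ℂ 𝔥)) : Prop where
  root_mem : ∀ i, R.root i ∈ P
  integral : ∀ μ ∈ P, ∀ i, ∃ z : ℤ, μ (R.coroot i) = z
  exists_basis : ∃ (r : ℕ) (b : Basis (Fin ℓ ⊕ Fin r) ℂ (Dual ℂ 𝔥)),
    (∀ i j, b (Sum.inl i) (R.coroot j) = if i = j then 1 else 0) ∧
    P = AddSubgroup.closure (Set.range b)

/-- The elements of `S ∩ P` on which `f` takes the value `m`. -/
def degSet {P : AddSubgroup (Dual ℂ 𝔥)} (f : P →+ ℤ) (S : Set (Dual ℂ 𝔥)) (m : ℤ) :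
    Set (Dual ℂ 𝔥) :=
  {μ | μ ∈ S ∧ ∃ h : μ ∈ P, f ⟨μ, h⟩ = m}

/-- The conditions on a `ℤ`-linear `f : P → ℤ` that make `V` a standard graded module: `Δ_m` and
`wts_m(V)` are finite, `Δ_m` is positive, `{0}`, or negative according to the sign of `m`, and
the weights in `wts_m(V)` are pairwise incomparable in the dominance order. Here `Δ_m` is taken in
`Δ ∪ {0}`. -/
structure IsStandardGrading (V : Type*) [AddCommGroup V] [Module ℂ V]
    [LieRingModule R.KacMoody V] [LieModule ℂ R.KacMoody V]
    {P : AddSubgroup (Dual ℂ 𝔥)} (f : P →+ ℤ) : Prop where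
  finite_roots : ∀ m, (degSet f (R.roots ∪ {0}) m).Finite
  finite_wts : ∀ m, (degSet f (R.wts V) m).Finite
  pos : ∀ m, 0 < m → degSet f (R.roots ∪ {0}) m ⊆ R.posRoots
  zero : degSet f (R.roots ∪ {0}) 0 = {0}
  neg : ∀ m, m < 0 → degSet f (R.roots ∪ {0}) m ⊆ R.negRoots
  incomparable : ∀ m, ∀ μ ∈ degSet f (R.wts V) m, ∀ ν ∈ degSet f (R.wts V) m,
    ν - μ ∈ R.Qplus → μ = ν

/-! ### Gradings and completions of `𝔤` and `V` -/

section Graded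

variable {P : AddSubgroup (Dual ℂ 𝔥)} (f : P →+ ℤ)

/-- `𝔤_m`, the sum of the `𝔤_α` with `α ∈ Δ_m`. -/
def gDeg (m : ℤ) : Submodule ℂ R.KacMoody :=
  ⨆ α ∈ degSet f (R.roots ∪ {0}) m, R.weightSpace R.KacMoody α

variable (V : Type*) [AddCommGroup V] [Module ℂ V] [LieRingModule R.KacMoody V]
  [LieModule ℂ R.KacMoody V]

/-- `V_m`, the sum of the `V_μ` with `μ ∈ wts_m(V)`. -/
def vDeg (m : ℤ) : Submodule ℂ V :=
  ⨆ μ ∈ degSet f (R.wts V) m, R.weightSpace V μ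

variable {V}

theorem lie_mem_weightSpace {α μ : Dual ℂ 𝔥} {x : R.KacMoody} {v : V}
    (hx : x ∈ R.weightSpace R.KacMoody α) (hv : v ∈ R.weightSpace V μ) :
    ⁅x, v⁆ ∈ R.weightSpace V (α + μ) := by
  intro h
  rw [leibniz_lie, hx h, hv h, smul_lie, lie_smul, LinearMap.add_apply, add_smul]

theorem lie_mem_of_degSet {S : Set (Dual ℂ 𝔥)} (hS : ∀ μ, R.weightSpace V μ ≠ ⊥ → μ ∈ S)
    {i j k : ℤ} (hk : i + j = k) {x : R.KacMoody} {v : V} (hx : x ∈ R.gDeg f i)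
    (hv : v ∈ ⨆ μ ∈ degSet f S j, R.weightSpace V μ) :
    ⁅x, v⁆ ∈ ⨆ μ ∈ degSet f S k, R.weightSpace V μ := by
  subst hk
  rw [gDeg] at hx
  induction hx using Submodule.iSup_induction' with
  | zero => simp
  | add a b _ _ ha hb => rw [add_lie]; exact Submodule.add_mem _ ha hb
  | mem α x hx =>
    induction hx using Submodule.iSup_induction' with
    | zero => simp
    | add a b _ _ ha hb => rw [add_lie]; exact Submodule.add_mem _ ha hb
    | mem hα x hx =>
      induction hv using Submodule.iSup_induction' with
      | zero => simp
      | add a b _ _ ha hb => rw [lie_add]; exact Submodule.add_mem _ ha hb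
      | mem μ v hv =>
        induction hv using Submodule.iSup_induction' with
        | zero => simp
        | add a b _ _ ha hb => rw [lie_add]; exact Submodule.add_mem _ ha hb
        | mem hμ v hv =>
          have hmem := R.lie_mem_weightSpace hx hv
          by_cases h0 : R.weightSpace V (α + μ) = ⊥
          · rw [h0, Submodule.mem_bot] at hmem
            rw [hmem]
            exact Submodule.zero_mem _
          · obtain ⟨-, hαP, hα'⟩ := hα
            obtain ⟨-, hμP, hμ'⟩ := hμ
            have hd : α + μ ∈ degSet f S (i + j) := by
              refine ⟨hS _ h0, P.add_mem hαP hμP, ?_⟩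
              rw [← hα', ← hμ', ← map_add]
              rfl
            exact Submodule.mem_iSup_of_mem (α + μ) (Submodule.mem_iSup_of_mem hd hmem)

theorem lie_mem_vDeg {i j k : ℤ} (hk : i + j = k) {x : R.KacMoody} {v : V}
    (hx : x ∈ R.gDeg f i) (hv : v ∈ R.vDeg f V j) : ⁅x, v⁆ ∈ R.vDeg f V k :=
  R.lie_mem_of_degSet f (fun _ h => h) hk hx hv

theorem lie_mem_gDeg {i j k : ℤ} (hk : i + j = k) {x y : R.KacMoody}
    (hx : x ∈ R.gDeg f i) (hy : y ∈ R.gDeg f j) : ⁅x, y⁆ ∈ R.gDeg f k :=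
  R.lie_mem_of_degSet f (fun μ h => by
    by_cases h0 : μ = 0
    · exact Or.inr h0
    · exact Or.inl ⟨h0, h⟩) hk hx hy

/-- The completion of `𝔤`. -/
abbrev gHat : Submodule ℂ (ℤ → R.KacMoody) := Completion (R.gDeg f)

/-- The completion of `V`. -/
abbrev vHat (V : Type*) [AddCommGroup V] [Module ℂ V] [LieRingModule R.KacMoody V]
    [LieModule ℂ R.KacMoody V] : Submodule ℂ (ℤ → V) := Completion (R.vDeg f V)

/-- `n̂⁺_m = ∏_{k ≥ m} 𝔤_k`. -/
abbrev nHat (m : ℤ) : Submodule ℂ (R.gHat f) := tail (R.gDeg f) m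

theorem rho_finite (x : R.gHat f) (v : R.vHat f V) (k : ℤ) :
    (Function.support fun i : ℤ =>
      ⁅(x : ℤ → R.KacMoody) i, (v : ℤ → V) (k - i)⁆).Finite := by
  obtain ⟨N, hN⟩ := x.2.2
  obtain ⟨N', hN'⟩ := v.2.2
  refine (Set.finite_Icc N (k - N')).subset fun i hi => ?_
  by_contra hmem
  apply hi
  rcases lt_or_ge i N with h | h
  · simp [hN i h]
  · have : k - i < N' := by
      by_contra hlt
      exact hmem ⟨h, by omega⟩
    simp [hN' _ this]

/-- The extension of the representation to the completions,
`(ρ(x) v)_k = ∑_i x_i · v_{k-i}` (a finite sum). -/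
def rho (V : Type*) [AddCommGroup V] [Module ℂ V] [LieRingModule R.KacMoody V]
    [LieModule ℂ R.KacMoody V] : R.gHat f →ₗ[ℂ] End ℂ (R.vHat f V) :=
  LinearMap.mk₂ ℂ
    (fun x v => ⟨fun k => ∑ᶠ i : ℤ, ⁅(x : ℤ → R.KacMoody) i, (v : ℤ → V) (k - i)⁆, by
      refine ⟨fun k => ?_, ?_⟩
      · exact finsum_induction (p := fun y => y ∈ R.vDeg f V k) (Submodule.zero_mem _)
          (fun _ _ => Submodule.add_mem _)
          (fun i => R.lie_mem_vDeg f (by omega) (x.2.1 i) (v.2.1 (k - i)))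
      · obtain ⟨N, hN⟩ := x.2.2
        obtain ⟨N', hN'⟩ := v.2.2
        refine ⟨N + N', fun m hm => ?_⟩
        refine (finsum_congr fun i => ?_).trans finsum_zero
        rcases lt_or_ge i N with h | h
        · simp [hN i h]
        · simp [hN' (m - i) (by omega)]⟩)
    (fun x y v => by
      ext k
      simp only [Submodule.coe_add, Pi.add_apply, add_lie]
      exact finsum_add_distrib (R.rho_finite f x v k) (R.rho_finite f y v k))
    (fun c x v => by
      ext k
      simp only [Submodule.coe_smul, Pi.smul_apply, smul_lie]
      exact (smul_finsum' c (R.rho_finite f x v k)).symm)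
    (fun x v w => by
      ext k
      simp only [Submodule.coe_add, Pi.add_apply, lie_add]
      exact finsum_add_distrib (R.rho_finite f x v k) (R.rho_finite f x w k))
    (fun c x v => by
      ext k
      simp only [Submodule.coe_smul, Pi.smul_apply, lie_smul]
      exact (smul_finsum' c (R.rho_finite f x v k)).symm)

theorem rho_raisesBy {m : ℤ} {x : R.gHat f} (hx : x ∈ R.nHat f m) :
    RaisesBy m (R.rho f V x) := by
  intro k v hv j hj
  refine (finsum_congr fun i => ?_).trans finsum_zero
  rcases lt_or_ge i m with h | h
  · simp [hx i h]
  · simp [hv (j - i) (by omega)]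

variable (V)

/-- `exp(ρ(x)) ∈ GL(V̂)` for `x ∈ n̂⁺ = n̂⁺_1`. -/
def expRho (x : R.nHat f 1) : LinearMap.GeneralLinearGroup ℂ (R.vHat f V) :=
  (isUnit_of_sub_one (expEnd_sub_one le_rfl le_rfl (R.rho f V x)
    (R.rho_raisesBy f x.2) (R.rho_raisesBy f x.2))).unit

variable {V}

/-- The inclusion of `𝔤_k` in `n̂⁺` for `k ≥ 1`, as families concentrated in degree `k`. -/
def homog (k : ℕ) (hk : 1 ≤ k) (x : R.gDeg f k) : R.nHat f 1 :=
  ⟨⟨Pi.single (k : ℤ) (x : R.KacMoody), by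
    refine ⟨fun m => ?_, k, fun m hm => by simp [hm.ne]⟩
    rcases eq_or_ne m k with rfl | h
    · simp
    · simp [h]⟩, by
    intro j hj
    have : j ≠ k := by omega
    simp [this]⟩

/-- The inclusion of `n̂⁺_n` in `n̂⁺` for `n ≥ 1`. -/
def incl (n : ℕ) (hn : 1 ≤ n) (x : R.nHat f n) : R.nHat f 1 :=
  ⟨x, tail_mono (by omega) x.2⟩

theorem homog_mem (k : ℕ) (hk : 1 ≤ k) (x : R.gDeg f k) :
    (R.homog f k hk x : R.gHat f) ∈ R.nHat f k := by
  intro j hj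
  simp [homog, hj.ne]

/-- `n̂⁺_{n+1}` as a subgroup of the additive group `n̂⁺_n`. -/
def nHatSucc (n : ℕ) : AddSubgroup (R.nHat f n) where
  carrier := {x | (x : R.gHat f) ∈ R.nHat f (n + 1 : ℕ)}
  add_mem' := fun ha hb => (R.nHat f (n + 1 : ℕ)).add_mem ha hb
  zero_mem' := (R.nHat f (n + 1 : ℕ)).zero_mem
  neg_mem' := fun ha => (R.nHat f (n + 1 : ℕ)).neg_mem ha

/-! ### The complete pro-unipotent groups -/

variable (V)

/-- The partial product `exp(ρ(x_{n+N-1})) ⋯ exp(ρ(x_{n+1})) exp(ρ(x_n))`. -/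
def partialProd (n : ℕ) (hn : 1 ≤ n) (x : ∀ k : ℕ, R.gDeg f k) :
    ℕ → LinearMap.GeneralLinearGroup ℂ (R.vHat f V)
  | 0 => 1
  | N + 1 => R.expRho f V (R.homog f (n + N) (by omega) (x (n + N))) * partialProd n hn x N

theorem partialProd_step (n : ℕ) (hn : 1 ≤ n) (x : ∀ k : ℕ, R.gDeg f k) (N : ℕ) :
    RaisesBy (n + N : ℤ)
      ((R.expRho f V (R.homog f (n + N) (by omega) (x (n + N))) :
        End ℂ (R.vHat f V)) - 1) := by
  have h := R.homog_mem f (n + N) (by omega) (x (n + N))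
  push_cast at h
  exact expEnd_sub_one le_rfl (by omega) _ (R.rho_raisesBy f (Subtype.prop _))
    (R.rho_raisesBy f h)

theorem partialProd_sub_one (n : ℕ) (hn : 1 ≤ n) (x : ∀ k : ℕ, R.gDeg f k) (N : ℕ) :
    RaisesBy 1 ((R.partialProd f V n hn x N : End ℂ (R.vHat f V)) - 1) := by
  induction N with
  | zero =>
    intro k v _
    simp [partialProd]
  | succ N ih =>
    intro k v hv
    have h1 := ih k v hv
    have h2 : (R.partialProd f V n hn x N : End ℂ (R.vHat f V)) v
        ∈ tail (R.vDeg f V) k := by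
      have := Submodule.add_mem _ (tail_mono (by omega) h1) hv
      simpa using this
    have h3 := tail_mono (j := k + 1) (by omega) (R.partialProd_step f V n hn x N k _ h2)
    have := Submodule.add_mem _ h3 h1
    simpa [partialProd] using this

theorem partialProd_mem (n : ℕ) (hn : 1 ≤ n) (x : ∀ k : ℕ, R.gDeg f k) (N : ℕ) (k : ℤ)
    (v : R.vHat f V) (hv : v ∈ tail (R.vDeg f V) k) :
    (R.partialProd f V n hn x N : End ℂ (R.vHat f V)) v ∈ tail (R.vDeg f V) k := by
  have := Submodule.add_mem _ (tail_mono (by omega) (R.partialProd_sub_one f V n hn x N k v hv)) hv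
  simpa using this

theorem partialProd_stable (n : ℕ) (hn : 1 ≤ n) (x : ∀ k : ℕ, R.gDeg f k)
    (v : R.vHat f V) (k : ℤ) :
    ∃ w, ∀ᶠ N in Filter.atTop,
      (((R.partialProd f V n hn x N : End ℂ (R.vHat f V)) v : R.vHat f V) : ℤ → V) k = w := by
  obtain ⟨K, hK⟩ := exists_mem_tail v
  refine ⟨(((R.partialProd f V n hn x (k - K).toNat : End ℂ (R.vHat f V)) v : R.vHat f V) :
    ℤ → V) k, Filter.eventually_atTop.mpr ⟨(k - K).toNat, fun N hN => ?_⟩⟩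
  induction N, hN using Nat.le_induction with
  | base => rfl
  | succ N hN ih =>
    rw [← ih]
    have := R.partialProd_step f V n hn x N K _ (R.partialProd_mem f V n hn x N K v hK) k
      (by omega)
    simpa [partialProd, sub_eq_zero] using this

/-- The underlying operator of `∏_{k ≥ n} exp(ρ(x_k))` (read from right to left): the limit of
the partial products, each coordinate of which is eventually constant on every vector. -/
def infProdEnd (n : ℕ) (hn : 1 ≤ n) (x : ∀ k : ℕ, R.gDeg f k) : End ℂ (R.vHat f V) :=
  coordLimit (fun N => (R.partialProd f V n hn x N : End ℂ (R.vHat f V)))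
    (R.partialProd_mem f V n hn x) (R.partialProd_stable f V n hn x)

theorem infProdEnd_sub_one (n : ℕ) (hn : 1 ≤ n) (x : ∀ k : ℕ, R.gDeg f k) :
    RaisesBy 1 (R.infProdEnd f V n hn x - 1) := by
  intro k v hv j hj
  obtain ⟨N, hN⟩ := (coordLimit_eventually _
    (R.partialProd_mem f V n hn x) (R.partialProd_stable f V n hn x) v j).exists
  have := R.partialProd_sub_one f V n hn x N k v hv j hj
  rw [← this]
  simp only [LinearMap.sub_apply, Submodule.coe_sub, Pi.sub_apply]
  rw [hN]
  rfl

/-- The infinite product `∏_{k ≥ n} exp(ρ(x_k))` as an element of `GL(V̂)`. -/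
def infProd (n : ℕ) (hn : 1 ≤ n) (x : ∀ k : ℕ, R.gDeg f k) :
    LinearMap.GeneralLinearGroup ℂ (R.vHat f V) :=
  (isUnit_of_sub_one (R.infProdEnd_sub_one f V n hn x)).unit

/-- The set `Û⁺_{V,n}` of all products `∏_{k ≥ n} exp(ρ(x_k))` with `x_k ∈ 𝔤_k`. -/
def UHat (n : ℕ) (hn : 1 ≤ n) : Set (LinearMap.GeneralLinearGroup ℂ (R.vHat f V)) :=
  {g | ∃ x : ∀ k : ℕ, R.gDeg f k, g = R.infProd f V n hn x}

end Graded

end Realization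

/-- The left coset `g S`. -/
def lcoset {G : Type*} [Group G] (g : G) (S : Set G) : Set G := {a | ∃ u ∈ S, a = g * u}

end Algebra

end KM

end

/-! A logarithmic derivative takes the place of the Baker–Campbell–Hausdorff formula. Let e be the
Euler operator, scaling degree k by k, on either completion; then [e, ρ(x)] = ρ(e x)
(`lie_euler_act`). A unipotent g on V̂ with [e, g] = ρ(L) g is determined by L (`eq_of_lie_euler`),
because bracketing with e multiplies the leading part of an operator raising degrees by d ≥ 1 by the
nonzero scalar d. For g = exp(ρ(x)) one finds L = ((exp(ad x) - 1)/ad x)(e x) (`lie_euler_expRho`),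
which is e x up to higher order, and a contraction argument shows that every L in n̂⁺_n arises from
some x in n̂⁺_n (`exists_logEuler_eq`). Hence a unipotent operator lies in exp(ρ(n̂⁺_n)) as soon as
its logarithmic derivative comes from n̂⁺_n (`IsLogDeriv.exists_eq_expRho`).

Left multiplication by exp(ρ(x)) turns L into `logEuler x` + exp(ad x) L, so products of
exponentials are exponentials, and leading terms give additivity modulo n̂⁺_{n+1}. For commutators,
exp(ρ(x)) conjugates exp(ρ(y)) to the exponential of exp(ad x) y = y + [x,y] + ..., and the last
factor exp(ρ(y))⁻¹ removes y. The logarithmic derivatives of the partial products of an infinite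
product converge, so its limit is an exponential; conversely the leading components of an exponent
can be split off one at a time. Thus `UHat` equals `expGroup`, and the claims become congruences
between exponents. When V is faithful, the leading component of x is recovered from exp(ρ(x)) = 1 +
ρ(x) + (order 2n). -/

noncomputable section

open Module

namespace KM

/-! ### Filtered operators on a completion -/

section Filtered

variable {M : Type*} [AddCommGroup M] [Module ℂ M] {W : ℤ → Submodule ℂ M}

variable (W) in
/-- The additive group structure of the completion; made a local instance as a shortcut for the
unifier. -/
abbrev completionAddCommGroup : AddCommGroup (Completion W) := Submodule.addCommGroup _

attribute [local instance] completionAddCommGroup LieRing.ofAssociativeRing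

theorem eq_zero_of_forall_mem_tail {v : Completion W} (K : ℤ)
    (h : ∀ N : ℕ, v ∈ tail W (K + N)) : v = 0 := by
  ext k
  exact h (k - K + 1).toNat k (by omega)

variable (W) in
/-- The operators raising degrees by at least `d`. -/
def raising (d : ℤ) : Submodule ℂ (End ℂ (Completion W)) where
  carrier := {T | RaisesBy d T}
  add_mem' ha hb k v hv := (tail W (k + d)).add_mem (ha k v hv) (hb k v hv)
  zero_mem' k _ _ := (tail W (k + d)).zero_mem
  smul_mem' c _ ha k v hv := (tail W (k + d)).smul_mem c (ha k v hv)

theorem raising_mono {d d' : ℤ} (h : d ≤ d') : raising W d' ≤ raising W d :=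
  fun _ hT k v hv => tail_mono (by omega) (hT k v hv)

theorem mul_mem_raising {a b c : ℤ} (hc : a + b = c) {S T : End ℂ (Completion W)}
    (hS : S ∈ raising W a) (hT : T ∈ raising W b) : S * T ∈ raising W c := by
  subst hc
  intro k v hv
  have := hS _ _ (hT k v hv)
  rwa [add_assoc, add_comm b a] at this

theorem one_mem_raising : (1 : End ℂ (Completion W)) ∈ raising W 0 := by
  intro k v hv
  simpa using hv

/-- The degree filtration on operators is separated, since every vector starts in some degree. This
is how all limits are compared below. -/
theorem eq_zero_of_forall_raising {T : End ℂ (Completion W)} (h : ∀ N : ℕ, T ∈ raising W N) :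
    T = 0 := by
  ext1 v
  obtain ⟨K, hK⟩ := exists_mem_tail v
  exact eq_zero_of_forall_mem_tail K fun N => h N K v hK

/-! ### Series converging in the degree filtration -/

/-- `S` is the sum of the series `∑ a i` for the filtration by degree raising. -/
def HasProSum (a : ℕ → End ℂ (Completion W)) (S : End ℂ (Completion W)) : Prop :=
  ∀ N : ℕ, S - ∑ i ∈ Finset.range N, a i ∈ raising W N

namespace HasProSum

variable {a b : ℕ → End ℂ (Completion W)} {S T : End ℂ (Completion W)}

theorem mem_zero (h : HasProSum a S) : S ∈ raising W 0 := by simpa using h 0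

theorem term_mem (h : HasProSum a S) (i : ℕ) : a i ∈ raising W i := by
  have h1 := h i
  have h2 := raising_mono (by simp) (h (i + 1)) (d := (i : ℤ))
  have := Submodule.sub_mem _ h1 h2
  rw [Finset.sum_range_succ] at this
  convert this using 1
  abel

theorem unique (hS : HasProSum a S) (hT : HasProSum a T) : S = T := by
  rw [← sub_eq_zero]
  refine eq_zero_of_forall_raising fun N => ?_
  have := Submodule.sub_mem _ (hS N) (hT N)
  convert this using 1
  abel

theorem neg (h : HasProSum a S) : HasProSum (fun i => -a i) (-S) := by
  intro N
  have := Submodule.neg_mem _ (h N)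
  rw [Finset.sum_neg_distrib]
  convert this using 1
  abel

theorem mul_const (h : HasProSum a S) (hT : T ∈ raising W 0) :
    HasProSum (fun i => a i * T) (S * T) := by
  intro N
  rw [← Finset.sum_mul, ← sub_mul]
  exact mul_mem_raising (by simp) (h N) hT

theorem const_mul (h : HasProSum a S) (hT : T ∈ raising W 0) :
    HasProSum (fun i => T * a i) (T * S) := by
  intro N
  rw [← Finset.mul_sum, ← mul_sub]
  exact mul_mem_raising (by simp) hT (h N)

/-- Prepending a term to a series. -/
theorem cons (h : HasProSum a S) {d : End ℂ (Completion W)} {c : ℕ → End ℂ (Completion W)}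
    (hd : d ∈ raising W 0) (ha : ∀ i : ℕ, a i ∈ raising W (i + 1)) (h0 : c 0 = d)
    (hc : ∀ i, c (i + 1) = a i) : HasProSum c (d + S) := by
  intro N
  cases N with
  | zero => simpa using Submodule.add_mem _ hd h.mem_zero
  | succ N =>
    rw [Finset.sum_range_succ', h0]
    simp_rw [hc]
    -- The first N + 1 terms of `c` involve only N terms of `a`. The surplus term `a N` already
    -- raises degrees by N + 1, so it can be added back.
    have h1 := h (N + 1)
    rw [Finset.sum_range_succ] at h1
    have h2 := Submodule.add_mem _ h1 (by simpa using ha N : a N ∈ raising W ((N + 1 : ℕ) : ℤ))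
    convert h2 using 1
    abel

/-- The Cauchy product of two series. -/
theorem mul (hS : HasProSum a S) (hT : HasProSum b T) :
    HasProSum (fun n => ∑ p ∈ Finset.HasAntidiagonal.antidiagonal n, a p.1 * b p.2) (S * T) := by
  intro N
  have h1 : S * T - (∑ i ∈ Finset.range N, a i) * ∑ i ∈ Finset.range N, b i ∈ raising W N := by
    have e : S * T - (∑ i ∈ Finset.range N, a i) * ∑ i ∈ Finset.range N, b i
        = (S - ∑ i ∈ Finset.range N, a i) * T
          + (∑ i ∈ Finset.range N, a i) * (T - ∑ i ∈ Finset.range N, b i) := by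
      rw [sub_mul, mul_sub]; abel
    rw [e]
    refine Submodule.add_mem _ (mul_mem_raising (by simp) (hS N) hT.mem_zero)
      (mul_mem_raising (zero_add _) (Submodule.sum_mem _ fun i _ => ?_) (hT N))
    exact raising_mono (by simp) (hS.term_mem i)
  have h2 : (∑ i ∈ Finset.range N, a i) * (∑ i ∈ Finset.range N, b i)
      - ∑ n ∈ Finset.range N, ∑ p ∈ Finset.HasAntidiagonal.antidiagonal n, a p.1 * b p.2 ∈ raising W N := by
    have e : ∑ n ∈ Finset.range N, ∑ p ∈ Finset.HasAntidiagonal.antidiagonal n, a p.1 * b p.2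
        = ∑ p ∈ (Finset.range N ×ˢ Finset.range N).filter (fun p => p.1 + p.2 < N),
          a p.1 * b p.2 := by
      rw [Finset.sum_sigma']
      refine Finset.sum_nbij' (fun x => x.2) (fun p => ⟨p.1 + p.2, p⟩) ?_ ?_ ?_ ?_ ?_
      · rintro ⟨n, p⟩ h
        simp only [Finset.mem_sigma, Finset.mem_range, Finset.mem_filter,
          Finset.HasAntidiagonal.mem_antidiagonal, Finset.mem_product] at h ⊢
        omega
      · rintro p h
        exact Finset.mem_sigma.mpr ⟨Finset.mem_range.mpr (Finset.mem_filter.mp h).2,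
          Finset.HasAntidiagonal.mem_antidiagonal.mpr rfl⟩
      · rintro ⟨n, p⟩ h
        simp only [Finset.mem_sigma, Finset.HasAntidiagonal.mem_antidiagonal] at h
        obtain ⟨-, rfl⟩ := h
        rfl
      · rintro p _
        rfl
      · rintro p _
        rfl
    -- The square minus the triangle leaves the products with total index at least N, each of which
    -- raises degrees by N.
    rw [e, Finset.sum_mul_sum, ← Finset.sum_product',
      ← Finset.sum_filter_add_sum_filter_not (Finset.range N ×ˢ Finset.range N)
        (fun p : ℕ × ℕ => p.1 + p.2 < N) (fun p => a p.1 * b p.2), add_sub_cancel_left]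
    refine Submodule.sum_mem _ fun p hp => ?_
    have hp : ¬ p.1 + p.2 < N := (Finset.mem_filter.mp hp).2
    have hp' : (N : ℤ) ≤ (p.1 : ℤ) + p.2 := by omega
    exact raising_mono hp' (mul_mem_raising rfl (hS.term_mem p.1) (hT.term_mem p.2))
  simpa using Submodule.add_mem _ h1 h2

end HasProSum

/-! ### Power series and exponentials of a degree-raising operator -/

/-- The power series `∑ c_n Tⁿ` in a degree-raising operator. -/
def series (c : ℕ → ℂ) (T : End ℂ (Completion W)) (hT : RaisesBy 1 T) : End ℂ (Completion W) :=
  proSum (fun n : ℕ => c n • T ^ n) (hT.proSummable le_rfl c)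

/-- The series is built from degree 1 alone, but the remainder improves with the true order d of
`T`. With N = 2 this isolates the linear term up to order 2d. -/
theorem series_sub_mem (c : ℕ → ℂ) {T : End ℂ (Completion W)} (hT : RaisesBy 1 T) {d : ℤ}
    (hd : 1 ≤ d) (hT' : RaisesBy d T) (N : ℕ) :
    series c T hT - ∑ i ∈ Finset.range N, c i • T ^ i ∈ raising W (N * d) := by
  intro k v hv j hj
  have hz : ∀ n, N ≤ n → (((c n • T ^ n) v : Completion W) : ℤ → M) j = 0 := by
    intro n hn
    have h1 : (N : ℤ) * d ≤ n * d := by gcongr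
    have := hT'.pow n k v hv j (by omega)
    simp [this]
  have h1 : ((series c T hT v : Completion W) : ℤ → M) j
      = ∑ n ∈ Finset.range N, (((c n • T ^ n) v : Completion W) : ℤ → M) j := by
    rw [show ((series c T hT v : Completion W) : ℤ → M) j = _ from proSum_apply _ _ v j,
      finsum_eq_sum_of_support_subset]
    intro n hn
    by_contra hlt
    exact hn (hz n (by simpa using hlt))
  simp [h1, LinearMap.sum_apply]

theorem hasProSum_series (c : ℕ → ℂ) {T : End ℂ (Completion W)} (hT : RaisesBy 1 T) :
    HasProSum (fun i => c i • T ^ i) (series c T hT) := by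
  intro N
  simpa using series_sub_mem c hT le_rfl hT N

/-- The coefficients of the exponential series. -/
def expCoeff (n : ℕ) : ℂ := (n.factorial : ℂ)⁻¹

theorem expCoeff_mul_choose {n : ℕ} {p : ℕ × ℕ} (hp : p ∈ Finset.HasAntidiagonal.antidiagonal n) :
    expCoeff n * (n.choose p.1 : ℂ) = expCoeff p.1 * expCoeff p.2 := by
  rw [Finset.HasAntidiagonal.mem_antidiagonal] at hp
  obtain ⟨i, j⟩ := p
  simp only at hp ⊢
  subst hp
  rw [Nat.cast_add_choose]
  have h1 : ((i + j).factorial : ℂ) ≠ 0 := by exact_mod_cast (i + j).factorial_ne_zero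
  have h2 : (i.factorial : ℂ) ≠ 0 := by exact_mod_cast i.factorial_ne_zero
  have h3 : (j.factorial : ℂ) ≠ 0 := by exact_mod_cast j.factorial_ne_zero
  simp only [expCoeff]
  field_simp

theorem hasProSum_expEnd {X : End ℂ (Completion W)} (hX : RaisesBy 1 X) :
    HasProSum (fun i => expCoeff i • X ^ i) (expEnd le_rfl X hX) :=
  hasProSum_series expCoeff hX

/-- By the binomial theorem the Cauchy product is the exponential series of X + (-X) = 0. -/
theorem expEnd_mul_expEnd_neg {X : End ℂ (Completion W)} (hX : RaisesBy 1 X)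
    (hX' : RaisesBy 1 (-X)) : expEnd le_rfl X hX * expEnd le_rfl (-X) hX' = 1 := by
  refine ((hasProSum_expEnd hX).mul (hasProSum_expEnd hX')).unique ?_
  have key : ∀ n : ℕ, ∑ p ∈ Finset.HasAntidiagonal.antidiagonal n,
      (expCoeff p.1 • X ^ p.1) * (expCoeff p.2 • (-X) ^ p.2) = expCoeff n • (X + -X) ^ n := by
    intro n
    rw [(Commute.neg_right (Commute.refl X)).add_pow', Finset.smul_sum]
    refine Finset.sum_congr rfl fun p hp => ?_
    rw [smul_mul_smul_comm, ← expCoeff_mul_choose hp, mul_smul, Nat.cast_smul_eq_nsmul]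
  simp_rw [key]
  intro N
  cases N with
  | zero => simpa using one_mem_raising
  | succ N => simp [Finset.sum_range_succ', expCoeff]

/-- Left multiplication by X is the sum of ad X and right multiplication by X. These commute, so the
binomial theorem applies. -/
theorem pow_mul_eq_sum {A : Type*} [Ring A] [Algebra ℂ A] (X Y : A) (n : ℕ) :
    X ^ n * Y = ∑ p ∈ Finset.HasAntidiagonal.antidiagonal n,
      n.choose p.1 • (((LieAlgebra.ad ℂ A X) ^ p.1) Y * X ^ p.2) := by
  have hc : Commute (LieAlgebra.ad ℂ A X) (LinearMap.mulRight ℂ X) := by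
    rw [LieAlgebra.ad_eq_lmul_left_sub_lmul_right]
    exact (LinearMap.commute_mulLeft_right (R := ℂ) X X).sub_left (Commute.refl _)
  have hsum : LinearMap.mulLeft ℂ X = LieAlgebra.ad ℂ A X + LinearMap.mulRight ℂ X := by
    rw [LieAlgebra.ad_eq_lmul_left_sub_lmul_right]
    simp
  have hpow : X ^ n * Y = ((LinearMap.mulLeft ℂ X) ^ n) Y := by
    rw [LinearMap.pow_mulLeft, LinearMap.mulLeft_apply]
  rw [hpow, hsum, hc.add_pow', LinearMap.sum_apply]
  refine Finset.sum_congr rfl fun p _ => ?_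
  rw [LinearMap.smul_apply, (hc.pow_pow p.1 p.2).eq, Module.End.mul_apply, LinearMap.pow_mulRight,
    LinearMap.mulRight_apply]

/-- `exp(X) Y = (exp(ad X) Y) exp(X)`. -/
theorem expEnd_mul_eq {X Y Y' : End ℂ (Completion W)} (hX : RaisesBy 1 X)
    (hY : Y ∈ raising W 0)
    (hY' : HasProSum (fun i => expCoeff i • ((LieAlgebra.ad ℂ (End ℂ (Completion W)) X) ^ i) Y) Y') :
    expEnd le_rfl X hX * Y = Y' * expEnd le_rfl X hX := by
  refine HasProSum.unique ?_ (hY'.mul (hasProSum_expEnd hX))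
  have h := (hasProSum_expEnd hX).mul_const hY
  convert h using 2 with n
  rw [smul_mul_assoc, pow_mul_eq_sum, Finset.smul_sum]
  refine Finset.sum_congr rfl fun p hp => ?_
  rw [smul_mul_smul_comm, ← expCoeff_mul_choose hp, mul_smul, Nat.cast_smul_eq_nsmul]

/-- If `T` intertwines `Y` and `Y'`, it intertwines their exponentials. -/
theorem expEnd_intertwine {T Y Y' : End ℂ (Completion W)} (hT : T ∈ raising W 0)
    (hY : RaisesBy 1 Y) (hY' : RaisesBy 1 Y') (h : T * Y = Y' * T) :
    T * expEnd le_rfl Y hY = expEnd le_rfl Y' hY' * T := by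
  refine ((hasProSum_expEnd hY).const_mul hT).unique ?_
  convert (hasProSum_expEnd hY').mul_const hT using 2 with n
  rw [mul_smul_comm, smul_mul_assoc]
  congr 1
  exact (SemiconjBy.pow_right (show SemiconjBy T Y Y' from h) n)

/-! ### The Euler operator -/

variable (W) in
/-- Componentwise multiplication by scalars depending on the degree. -/
def degreeScale (c : ℤ → ℂ) : End ℂ (Completion W) where
  toFun v := ⟨fun k => c k • (v : ℤ → M) k, fun k => (W k).smul_mem _ (v.2.1 k), by
    obtain ⟨N, hN⟩ := v.2.2
    exact ⟨N, fun m hm => by simp [hN m hm]⟩⟩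
  map_add' v w := by ext k; simp
  map_smul' a v := by ext k; exact smul_comm _ _ _

variable (W) in
/-- The Euler operator, multiplying the component of degree `k` by `k`. -/
abbrev euler : End ℂ (Completion W) := degreeScale W fun k => k

theorem degreeScale_apply (c : ℤ → ℂ) (v : Completion W) (k : ℤ) :
    ((degreeScale W c v : Completion W) : ℤ → M) k = c k • (v : ℤ → M) k := rfl

theorem degreeScale_mem_raising (c : ℤ → ℂ) : degreeScale W c ∈ raising W 0 := by
  intro k v hv j hj
  rw [degreeScale_apply, hv j (by omega), smul_zero]

theorem degreeScale_mem_tail (c : ℤ → ℂ) {k : ℤ} {v : Completion W} (hv : v ∈ tail W k) :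
    degreeScale W c v ∈ tail W k := by
  simpa using degreeScale_mem_raising c k v hv

/-- On the component of `T` from degree k to degree k + d, the bracket with the Euler operator is
multiplication by (k + d) - k = d ≠ 0. If the bracket has no such component, neither does `T`. -/
theorem mem_raising_succ_of_lie_euler {d : ℤ} (hd : 1 ≤ d) {T : End ℂ (Completion W)}
    (hT : T ∈ raising W d) (h : ⁅euler W, T⁆ ∈ raising W (d + 1)) : T ∈ raising W (d + 1) := by
  intro k v hv j hj
  rcases lt_or_ge j (k + d) with hlt | hge
  · exact hT k v hv j hlt
  obtain rfl : j = k + d := by omega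
  have h1 := h k v hv (k + d) (by omega)
  -- Modulo higher degrees, the Euler operator acts on `v` as the scalar k.
  have h2 : euler W v - (k : ℂ) • v ∈ tail W (k + 1) := by
    intro i hi
    rcases eq_or_ne i k with rfl | hne
    · simp [degreeScale_apply]
    · have := hv i (by omega)
      simp [degreeScale_apply, this]
  have h3 := hT _ _ h2 (k + d) (by omega)
  simp only [map_sub, map_smul, Submodule.coe_sub, Pi.sub_apply, Submodule.coe_smul,
    Pi.smul_apply, Ring.lie_def, LinearMap.sub_apply, Module.End.mul_apply,
    degreeScale_apply] at h1 h3
  rw [sub_eq_zero] at h1 h3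
  rw [← h1, ← sub_eq_zero, ← sub_smul] at h3
  have hne : (((k + d : ℤ) : ℂ) - k) ≠ 0 := by
    push_cast
    simp only [add_sub_cancel_left]
    exact_mod_cast (by omega : d ≠ 0)
  exact (smul_eq_zero.mp h3).resolve_left hne

/-- A unipotent solution of `[e, F] = L F` is unique. -/
theorem eq_of_lie_euler {F H L : End ℂ (Completion W)} (hF : F - 1 ∈ raising W 1)
    (hH : H - 1 ∈ raising W 1) (hL : L ∈ raising W 1) (h1 : ⁅euler W, F⁆ = L * F)
    (h2 : ⁅euler W, H⁆ = L * H) : F = H := by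
  have h3 : ⁅euler W, F - H⁆ = L * (F - H) := by rw [lie_sub, h1, h2, mul_sub]
  -- The difference solves the same linear equation. As `L` gains one degree, so does the bracket,
  -- and hence the difference itself.
  have h4 : ∀ N : ℕ, F - H ∈ raising W (N + 1) := by
    intro N
    induction N with
    | zero => simpa using Submodule.sub_mem _ hF hH
    | succ N ih =>
      push_cast
      refine mem_raising_succ_of_lie_euler (by omega) ih ?_
      rw [h3]
      exact mul_mem_raising (by ring) hL ih
  rw [← sub_eq_zero]
  exact eq_zero_of_forall_raising fun N => raising_mono (by omega) (h4 N)

/-! ### Completeness and density -/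

/-- The element of the completion concentrated in degree `i`. -/
def single (i : ℤ) (w : W i) : Completion W :=
  ⟨Pi.single i (w : M), by
    refine ⟨fun m => ?_, i, fun m hm => by simp [hm.ne]⟩
    rcases eq_or_ne m i with rfl | h
    · simp
    · simp [h]⟩

theorem single_apply_same (i : ℤ) (w : W i) : ((single i w : Completion W) : ℤ → M) i = w := by
  simp [single]

theorem single_apply_ne {i j : ℤ} (h : j ≠ i) (w : W i) :
    ((single i w : Completion W) : ℤ → M) j = 0 := by
  simp [single, h]

theorem single_mem_tail (i : ℤ) (w : W i) : single i w ∈ tail W i :=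
  fun _ hj => single_apply_ne hj.ne w

/-- The leading component of an element of `tail W i`. -/
def lead (i : ℤ) (v : Completion W) : Completion W := single i ⟨(v : ℤ → M) i, v.2.1 i⟩

theorem sub_lead_mem_tail {i : ℤ} {v : Completion W} (hv : v ∈ tail W i) :
    v - lead i v ∈ tail W (i + 1) := by
  intro j hj
  rcases eq_or_ne j i with rfl | h
  · simp [lead, single_apply_same]
  · simp [lead, single_apply_ne h, hv j (by omega)]

/-- An element bounded below is a finite sum of homogeneous elements plus an element of the tail.
Linear identities can thus be checked on homogeneous elements, with the tail controlled by degree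
alone. -/
theorem mem_of_single_of_tail (S : Submodule ℂ (Completion W)) (N : ℤ)
    (hs : ∀ i w, single i w ∈ S) (ht : tail W N ≤ S) (v : Completion W) : v ∈ S := by
  obtain ⟨K, hK⟩ := exists_mem_tail v
  obtain ⟨m, hm⟩ : ∃ m : ℕ, N ≤ K + m := ⟨(N - K).toNat, by omega⟩
  induction m generalizing K v with
  | zero => exact ht (tail_mono (by simpa using hm) hK)
  | succ m ih =>
    have := S.add_mem (ih (v - lead K v) (K + 1) (sub_lead_mem_tail hK) (by push_cast at hm; omega))
      (show lead K v ∈ S from hs K _)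
    rwa [sub_add_cancel] at this

/-- The completion is complete. -/
theorem exists_limit (s : ℕ → Completion W) (n : ℤ)
    (hs : ∀ N : ℕ, s (N + 1) - s N ∈ tail W (n + N)) :
    ∃ v, ∀ N : ℕ, v - s N ∈ tail W (n + N) := by
  have hst : ∀ (N m : ℕ), s (N + m) - s N ∈ tail W (n + N) := by
    intro N m
    induction m with
    | zero => simp
    | succ m ih =>
      have := Submodule.add_mem _ (tail_mono (by push_cast; omega) (hs (N + m))) ih
      simpa [add_assoc] using this
  obtain ⟨K, hK⟩ := exists_mem_tail (s 0)
  -- From this index on, the coordinate of degree k no longer changes.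
  let idx : ℤ → ℕ := fun k => (k - n + 1).toNat
  have hidx : ∀ k (N : ℕ), k < n + N → ((s (idx k) : Completion W) : ℤ → M) k = (s N : ℤ → M) k := by
    intro k N hk
    have h := hst (idx k) (N - idx k) k (by simp only [idx]; omega)
    rw [show idx k + (N - idx k) = N by simp only [idx]; omega] at h
    exact (sub_eq_zero.mp h).symm
  refine ⟨⟨fun k => (s (idx k) : ℤ → M) k, fun k => (s (idx k)).2.1 k, min K n, fun m hm => ?_⟩,
    fun N k hk => ?_⟩
  · simp only
    rw [hidx m 0 (by simp; omega)]
    exact hK m (by omega)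
  · simp [hidx k N hk]

/-- A contraction of `tail W n` has a fixed point. -/
theorem exists_fixedPoint (C : Completion W → Completion W) (n : ℤ)
    (hn : ∀ v ∈ tail W n, C v ∈ tail W n)
    (hC : ∀ a, n ≤ a → ∀ v ∈ tail W n, ∀ w ∈ tail W n, v - w ∈ tail W a →
      C v - C w ∈ tail W (a + 1)) : ∃ v ∈ tail W n, C v = v := by
  let s : ℕ → Completion W := fun N => C^[N] 0
  have hs0 : ∀ N, s N ∈ tail W n := by
    intro N
    induction N with
    | zero => simp [s]
    | succ N ih =>
      simp only [s, Function.iterate_succ_apply']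
      exact hn _ ih
  have hs : ∀ N : ℕ, s (N + 1) - s N ∈ tail W (n + N) := by
    intro N
    induction N with
    | zero => simpa using Submodule.sub_mem _ (hs0 1) (hs0 0)
    | succ N ih =>
      have := hC _ (by omega) _ (hs0 _) _ (hs0 _) ih
      simp only [s, ← Function.iterate_succ_apply' C] at this
      push_cast
      rwa [← add_assoc]
  obtain ⟨v, hv⟩ := exists_limit s n hs
  have hvn : v ∈ tail W n := by
    have := Submodule.add_mem _ (hv 0) (by simpa using hs0 0)
    simpa using this
  refine ⟨v, hvn, sub_eq_zero.mp (eq_zero_of_forall_mem_tail n fun N => ?_)⟩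
  have h1 := hC _ (by omega) _ hvn _ (hs0 N) (hv N)
  have h2 : C (s N) = s (N + 1) := by simp only [s, Function.iterate_succ_apply']
  have h3 := hv (N + 1)
  rw [h2] at h1
  have := Submodule.sub_mem _ h1 (by push_cast at h3; rwa [← add_assoc] at h3)
  refine tail_mono (by omega) (?_ : _ ∈ tail W (n + N + 1))
  simpa using this

end Filtered

/-! ### Degenerate series and inversion of the Euler operator in positive degrees -/

section SeriesApply

variable {M : Type*} [AddCommGroup M] [Module ℂ M] {W : ℤ → Submodule ℂ M}

attribute [local instance] completionAddCommGroup

theorem series_apply_of_map_eq_zero (c : ℕ → ℂ) {T : End ℂ (Completion W)} (hT : RaisesBy 1 T)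
    {v : Completion W} (hv : T v = 0) : series c T hT v = c 0 • v := by
  obtain ⟨K, hK⟩ := exists_mem_tail v
  rw [← sub_eq_zero]
  refine eq_zero_of_forall_mem_tail K fun N => ?_
  have h := hasProSum_series c hT (N + 1) K v hK
  have hs : (∑ i ∈ Finset.range (N + 1), c i • T ^ i) v = c 0 • v := by
    rw [Finset.sum_range_succ']
    simp [LinearMap.sum_apply, pow_succ, hv]
  rw [LinearMap.sub_apply, hs] at h
  exact tail_mono (by push_cast; omega) h

theorem mem_tail_of_euler_mem {k : ℤ} {v : Completion W} (hv : v ∈ tail W 1)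
    (h : euler W v ∈ tail W k) : v ∈ tail W k := by
  intro j hj
  rcases lt_or_ge j 1 with h1 | h1
  · exact hv j h1
  · have h2 := h j hj
    rw [degreeScale_apply] at h2
    refine (smul_eq_zero.mp h2).resolve_left ?_
    exact_mod_cast (by omega : j ≠ 0)

theorem euler_degreeScale_inv {v : Completion W} (hv : v ∈ tail W 1) :
    euler W (degreeScale W (fun k => (k : ℂ)⁻¹) v) = v := by
  ext k
  rw [degreeScale_apply, degreeScale_apply]
  rcases eq_or_ne k 0 with rfl | h
  · rw [hv 0 (by omega)]
    simp
  · rw [smul_smul, mul_inv_cancel₀ (by exact_mod_cast h), one_smul]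

end SeriesApply

namespace Realization

variable {ℓ : ℕ} {A : Matrix (Fin ℓ) (Fin ℓ) ℤ} {𝔥 : Type*} [AddCommGroup 𝔥] [Module ℂ 𝔥]
  (R : Realization A 𝔥) {P : AddSubgroup (Dual ℂ 𝔥)} (f : P →+ ℤ)

attribute [local instance] completionAddCommGroup LieRing.ofAssociativeRing

/-! ### The action of the completion on a completed graded module -/

section Action

variable {V : Type*} [AddCommGroup V] [Module ℂ V] [LieRingModule R.KacMoody V]
  {W : ℤ → Submodule ℂ V}

theorem lie_support_finite (x : R.gHat f) (v : Completion W) (k : ℤ) :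
    (Function.support fun i : ℤ =>
      ⁅(x : ℤ → R.KacMoody) i, (v : ℤ → V) (k - i)⁆).Finite := by
  obtain ⟨N, hN⟩ := x.2.2
  obtain ⟨N', hN'⟩ := v.2.2
  refine (Set.finite_Icc N (k - N')).subset fun i hi => ?_
  by_contra hmem
  apply hi
  rcases lt_or_ge i N with h | h
  · simp [hN i h]
  · have : k - i < N' := by
      by_contra hlt
      exact hmem ⟨h, by omega⟩
    simp [hN' _ this]

variable [LieModule ℂ R.KacMoody V]

/-- A family of subspaces of a `𝔤`-module on which `𝔤_i` acts with degree `i`. -/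
def IsGraded (W : ℤ → Submodule ℂ V) : Prop :=
  ∀ ⦃i j k : ℤ⦄, i + j = k → ∀ ⦃x : R.KacMoody⦄, x ∈ R.gDeg f i → ∀ ⦃v : V⦄, v ∈ W j →
    ⁅x, v⁆ ∈ W k

/-- The action of the completion of `𝔤` on the completion of a graded module. -/
def act (hW : R.IsGraded f W) : R.gHat f →ₗ[ℂ] End ℂ (Completion W) :=
  LinearMap.mk₂ ℂ
    (fun x v => ⟨fun k => ∑ᶠ i : ℤ, ⁅(x : ℤ → R.KacMoody) i, (v : ℤ → V) (k - i)⁆, by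
      refine ⟨fun k => ?_, ?_⟩
      · exact finsum_induction (p := fun y => y ∈ W k) (Submodule.zero_mem _)
          (fun _ _ => Submodule.add_mem _)
          (fun i => hW (by omega) (x.2.1 i) (v.2.1 (k - i)))
      · obtain ⟨N, hN⟩ := x.2.2
        obtain ⟨N', hN'⟩ := v.2.2
        refine ⟨N + N', fun m hm => ?_⟩
        refine (finsum_congr fun i => ?_).trans finsum_zero
        rcases lt_or_ge i N with h | h
        · simp [hN i h]
        · simp [hN' (m - i) (by omega)]⟩)
    (fun x y v => by
      ext k
      simp only [Submodule.coe_add, Pi.add_apply, add_lie]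
      exact finsum_add_distrib (R.lie_support_finite f x v k) (R.lie_support_finite f y v k))
    (fun c x v => by
      ext k
      simp only [Submodule.coe_smul, Pi.smul_apply, smul_lie]
      exact (smul_finsum' c (R.lie_support_finite f x v k)).symm)
    (fun x v w => by
      ext k
      simp only [Submodule.coe_add, Pi.add_apply, lie_add]
      exact finsum_add_distrib (R.lie_support_finite f x v k) (R.lie_support_finite f x w k))
    (fun c x v => by
      ext k
      simp only [Submodule.coe_smul, Pi.smul_apply, lie_smul]
      exact (smul_finsum' c (R.lie_support_finite f x v k)).symm)

variable {f} (hW : R.IsGraded f W)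

theorem act_apply (x : R.gHat f) (v : Completion W) (k : ℤ) :
    ((R.act f hW x v : Completion W) : ℤ → V) k
      = ∑ᶠ i : ℤ, ⁅(x : ℤ → R.KacMoody) i, (v : ℤ → V) (k - i)⁆ := rfl

theorem act_mem_raising {m : ℤ} {x : R.gHat f} (hx : x ∈ R.nHat f m) :
    R.act f hW x ∈ raising W m := by
  intro k v hv j hj
  refine (finsum_congr fun i => ?_).trans finsum_zero
  rcases lt_or_ge i m with h | h
  · simp [hx i h]
  · simp [hv (j - i) (by omega)]

theorem act_single (i : ℤ) (a : R.gDeg f i) (v : Completion W) (k : ℤ) :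
    ((R.act f hW (single i a) v : Completion W) : ℤ → V) k
      = ⁅(a : R.KacMoody), (v : ℤ → V) (k - i)⁆ := by
  rw [act_apply, finsum_eq_single _ i, single_apply_same]
  intro j hj
  rw [single_apply_ne hj, zero_lie]

/-- By density it is enough to take x homogeneous of degree i, where the bracket produces the factor
k - (k - i) = i. -/
theorem lie_euler_act (x : R.gHat f) :
    ⁅euler W, R.act f hW x⁆ = R.act f hW (euler _ x) := by
  rw [← sub_eq_zero]
  refine eq_zero_of_forall_raising fun N => ?_
  let T : R.gHat f →ₗ[ℂ] End ℂ (Completion W) :=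
    { toFun := fun x => ⁅euler W, R.act f hW x⁆ - R.act f hW (euler _ x)
      map_add' := fun x y => by simp only [map_add, lie_add]; abel
      map_smul' := fun c x => by
        simp only [map_smul, Ring.lie_def, mul_smul_comm, smul_mul_assoc, smul_sub,
          RingHom.id_apply] }
  refine mem_of_single_of_tail ((raising W N).comap T) N (fun i a => ?_) (fun y hy => ?_) x
  · have : T (single i a) = 0 := by
      ext v k
      have he : euler _ (single i a) = (i : ℂ) • single i a := by
        ext j
        rcases eq_or_ne j i with rfl | h
        · simp [degreeScale_apply]
        · simp [degreeScale_apply, single_apply_ne h]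
      change (((⁅euler W, R.act f hW (single i a)⁆ - R.act f hW (euler _ (single i a))) v :
        Completion W) : ℤ → V) k = 0
      rw [he, map_smul]
      simp only [Ring.lie_def, LinearMap.sub_apply, Module.End.mul_apply, Submodule.coe_sub,
        Pi.sub_apply, LinearMap.smul_apply, Submodule.coe_smul, Pi.smul_apply, degreeScale_apply,
        act_single, lie_smul, ← sub_smul]
      push_cast
      rw [show (k : ℂ) - (k - i) - i = 0 by ring, zero_smul]
    rw [Submodule.mem_comap, this]
    exact Submodule.zero_mem _
  · refine Submodule.sub_mem _ ?_ (R.act_mem_raising hW (degreeScale_mem_tail _ hy))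
    rw [Ring.lie_def]
    exact Submodule.sub_mem _
      (mul_mem_raising (zero_add _) (degreeScale_mem_raising _) (R.act_mem_raising hW hy))
      (mul_mem_raising (add_zero _) (R.act_mem_raising hW hy) (degreeScale_mem_raising _))

variable (f) in
theorem isGraded_gDeg : R.IsGraded f (R.gDeg f) := fun _ _ _ h _ hx _ hy =>
  R.lie_mem_gDeg f h hx hy

variable (f) in
/-- The Lie bracket of the completion of `𝔤`, as the adjoint action. -/
def adHat : R.gHat f →ₗ[ℂ] End ℂ (R.gHat f) := R.act f (R.isGraded_gDeg f)

theorem adHat_mem_raising {m : ℤ} {x : R.gHat f} (hx : x ∈ R.nHat f m) :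
    R.adHat f x ∈ raising (R.gDeg f) m := R.act_mem_raising _ hx

theorem adHat_mem {a b : ℤ} {x y : R.gHat f} (hx : x ∈ R.nHat f a) (hy : y ∈ R.nHat f b) :
    R.adHat f x y ∈ R.nHat f (a + b) := by
  rw [add_comm]
  exact R.adHat_mem_raising hx b y hy

theorem adHat_single_single (i j : ℤ) (a : R.gDeg f i) (b : R.gDeg f j) :
    R.adHat f (single i a) (single j b)
      = single (i + j) ⟨⁅(a : R.KacMoody), (b : R.KacMoody)⁆, R.lie_mem_gDeg f rfl a.2 b.2⟩ := by
  ext k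
  rw [adHat, act_single]
  rcases eq_or_ne k (i + j) with rfl | h
  · rw [single_apply_same, add_sub_cancel_left, single_apply_same]
  · rw [single_apply_ne h, single_apply_ne (by omega), lie_zero]

/-- On homogeneous x and y this is the Jacobi identity in the module. Density is then applied in
each variable. -/
theorem act_adHat (x y : R.gHat f) :
    R.act f hW (R.adHat f x y) = ⁅R.act f hW x, R.act f hW y⁆ := by
  rw [← sub_eq_zero]
  refine eq_zero_of_forall_raising fun N => ?_
  let T : R.gHat f →ₗ[ℂ] R.gHat f →ₗ[ℂ] End ℂ (Completion W) :=
    LinearMap.mk₂ ℂ (fun x y => R.act f hW (R.adHat f x y) - ⁅R.act f hW x, R.act f hW y⁆)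
      (fun x x' y => by simp only [map_add, add_lie, LinearMap.add_apply]; abel)
      (fun c x y => by
        simp only [map_smul, Ring.lie_def, mul_smul_comm, smul_mul_assoc, smul_sub,
          LinearMap.smul_apply])
      (fun x y y' => by simp only [map_add, lie_add]; abel)
      (fun c x y => by
        simp only [map_smul, Ring.lie_def, mul_smul_comm, smul_mul_assoc, smul_sub])
  have hT : ∀ {a b : ℤ} {x y : R.gHat f}, x ∈ R.nHat f a → y ∈ R.nHat f b →
      T x y ∈ raising W (a + b) := by
    intro a b x y hx hy
    refine Submodule.sub_mem _ (R.act_mem_raising hW (R.adHat_mem hx hy)) ?_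
    rw [Ring.lie_def]
    exact Submodule.sub_mem _
      (mul_mem_raising rfl (R.act_mem_raising hW hx) (R.act_mem_raising hW hy))
      (mul_mem_raising (add_comm _ _) (R.act_mem_raising hW hy) (R.act_mem_raising hW hx))
  -- The cutoffs N - b and N - i are chosen so that the defect on the remaining tail raises degrees
  -- by N.
  obtain ⟨b, hb⟩ := exists_mem_tail y
  refine mem_of_single_of_tail ((raising W N).comap (T.flip y)) (N - b) (fun i a => ?_)
    (fun x' hx' => ?_) x
  · refine mem_of_single_of_tail ((raising W N).comap (T (single i a))) (N - i) (fun j c => ?_)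
      (fun y' hy' => ?_) y
    · have : T (single i a) (single j c) = 0 := by
        ext v k
        change (((R.act f hW (R.adHat f (single i a) (single j c))
          - ⁅R.act f hW (single i a), R.act f hW (single j c)⁆) v : Completion W) : ℤ → V) k = 0
        rw [adHat_single_single]
        simp only [Ring.lie_def, LinearMap.sub_apply, Module.End.mul_apply, Submodule.coe_sub,
          Pi.sub_apply, act_single]
        rw [lie_lie, show k - i - j = k - (i + j) by ring, show k - j - i = k - (i + j) by ring,
          sub_self]
      rw [Submodule.mem_comap, this]
      exact Submodule.zero_mem _
    · have := hT (single_mem_tail i a) hy'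
      rwa [add_sub_cancel] at this
  · have := hT hx' hb
    rwa [sub_add_cancel] at this

end Action

/-! ### Power series in the adjoint action -/

section AdSeries

variable {f}

/-- The series `∑ c_i ad(x)^i y`. -/
def adSeries (c : ℕ → ℂ) (x : R.nHat f 1) (y : R.gHat f) : R.gHat f :=
  series c (R.adHat f x) (R.adHat_mem_raising x.2) y

variable (c : ℕ → ℂ)

theorem adSeries_sub_sum_mem (x : R.nHat f 1) {y : R.gHat f} {a b : ℤ} (ha : 1 ≤ a)
    (hx : (x : R.gHat f) ∈ R.nHat f a) (hy : y ∈ R.nHat f b) (N : ℕ) :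
    R.adSeries c x y - ∑ i ∈ Finset.range N, c i • ((R.adHat f x) ^ i) y
      ∈ R.nHat f (b + N * a) := by
  have := series_sub_mem c (R.adHat_mem_raising x.2) ha (R.adHat_mem_raising hx) N b y hy
  simpa [adSeries, LinearMap.sum_apply] using this

theorem adSeries_mem (x : R.nHat f 1) {y : R.gHat f} {b : ℤ} (hy : y ∈ R.nHat f b) :
    R.adSeries c x y ∈ R.nHat f b := by
  simpa using R.adSeries_sub_sum_mem c x le_rfl x.2 hy 0

theorem adSeries_sub_mem (x : R.nHat f 1) {y : R.gHat f} {a b : ℤ} (ha : 1 ≤ a)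
    (hx : (x : R.gHat f) ∈ R.nHat f a) (hy : y ∈ R.nHat f b) :
    R.adSeries c x y - c 0 • y ∈ R.nHat f (b + a) := by
  simpa using R.adSeries_sub_sum_mem c x ha hx hy 1

theorem adHat_pow_mem {x y : R.gHat f} (hx : x ∈ R.nHat f 1) {b : ℤ} (hy : y ∈ R.nHat f b)
    (i : ℕ) : ((R.adHat f x) ^ i) y ∈ R.nHat f (b + i) := by
  simpa using RaisesBy.pow (R.adHat_mem_raising hx) i b y hy

/-- Each application of ad telescopes into an error in `x` and an error in the argument. Both gain a
degree, since everything lies in degrees at least 1; the two bounds are proved together for the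
induction. -/
theorem adHat_pow_sub_mem {x x' y y' : R.gHat f} (hx' : x' ∈ R.nHat f 1) (hx : x ∈ R.nHat f 1)
    (hy : y ∈ R.nHat f 1) {a : ℤ} (hxx : x - x' ∈ R.nHat f a) (hyy : y - y' ∈ R.nHat f a)
    (i : ℕ) : ((R.adHat f x) ^ i) y - ((R.adHat f x') ^ i) y' ∈ R.nHat f a ∧
      ((R.adHat f x) ^ (i + 1)) y - ((R.adHat f x') ^ (i + 1)) y' ∈ R.nHat f (a + 1) := by
  have step : ∀ i, ((R.adHat f x) ^ i) y - ((R.adHat f x') ^ i) y' ∈ R.nHat f a →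
      ((R.adHat f x) ^ (i + 1)) y - ((R.adHat f x') ^ (i + 1)) y' ∈ R.nHat f (a + 1) := by
    intro i hi
    simp only [pow_succ', Module.End.mul_apply]
    have h1 := R.adHat_mem hxx (tail_mono (by omega) (R.adHat_pow_mem hx hy i) :
      ((R.adHat f x) ^ i) y ∈ R.nHat f 1)
    have h2 := R.adHat_mem hx' hi
    rw [add_comm] at h2
    have := Submodule.add_mem _ h1 h2
    convert this using 1
    simp only [map_sub, LinearMap.sub_apply]
    abel
  induction i with
  | zero => exact ⟨by simpa using hyy, step 0 (by simpa using hyy)⟩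
  | succ i ih =>
    have := tail_mono (show a ≤ a + 1 by omega) ih.2
    exact ⟨this, step _ this⟩

/-- Only the constant term of the series sees a perturbation of order `a` at order `a`; every other
term moves it to order `a + 1`. -/
theorem adSeries_congr {x x' : R.nHat f 1} {y y' : R.gHat f} (hy : y ∈ R.nHat f 1)
    (hy' : y' ∈ R.nHat f 1) {a : ℤ} (hxx : (x : R.gHat f) - x' ∈ R.nHat f a)
    (hyy : y - y' ∈ R.nHat f a) :
    R.adSeries c x y - R.adSeries c x' y' - c 0 • (y - y') ∈ R.nHat f (a + 1) := by
  -- With `a.toNat + 1` terms kept, the remainders already lie in degrees at least `a + 1`.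
  have h1 := tail_mono (show a + 1 ≤ 1 + ((a.toNat + 1 : ℕ) : ℤ) * 1 by push_cast; omega)
    (R.adSeries_sub_sum_mem c x le_rfl x.2 hy (a.toNat + 1))
  have h2 := tail_mono (show a + 1 ≤ 1 + ((a.toNat + 1 : ℕ) : ℤ) * 1 by push_cast; omega)
    (R.adSeries_sub_sum_mem c x' le_rfl x'.2 hy' (a.toNat + 1))
  have h3 : ∑ i ∈ Finset.range a.toNat, c (i + 1) • (((R.adHat f x) ^ (i + 1)) y
      - ((R.adHat f x') ^ (i + 1)) y') ∈ R.nHat f (a + 1) :=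
    Submodule.sum_mem _ fun i _ => Submodule.smul_mem _ _
      (R.adHat_pow_sub_mem x'.2 x.2 hy hxx hyy i).2
  have := Submodule.add_mem _ (Submodule.sub_mem _ h1 h2) h3
  convert this using 1
  simp only [Finset.sum_range_succ', smul_sub, Finset.sum_sub_distrib, pow_zero,
    Module.End.one_apply]
  abel

theorem adSeries_of_adHat_eq_zero {x : R.nHat f 1} {y : R.gHat f} (h : R.adHat f x y = 0) :
    R.adSeries c x y = c 0 • y := series_apply_of_map_eq_zero c _ h

/-- `exp(ad x) y`. -/
abbrev adExp (x : R.nHat f 1) (y : R.gHat f) : R.gHat f := R.adSeries expCoeff x y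

/-- `((exp(ad x) - 1) / ad x) E(x)` where `E` is the Euler derivation. -/
abbrev logEuler (x : R.nHat f 1) : R.gHat f :=
  R.adSeries (fun i => expCoeff (i + 1)) x (euler _ (x : R.gHat f))

theorem expCoeff_zero : expCoeff 0 = 1 := by simp [expCoeff]

theorem expCoeff_one : expCoeff 1 = 1 := by simp [expCoeff]

theorem logEuler_mem {x : R.nHat f 1} {n : ℤ} (hx : (x : R.gHat f) ∈ R.nHat f n) :
    R.logEuler x ∈ R.nHat f n :=
  R.adSeries_mem _ _ (degreeScale_mem_tail _ hx)

theorem logEuler_sub_mem {x : R.nHat f 1} {n : ℤ} (hn : 1 ≤ n)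
    (hx : (x : R.gHat f) ∈ R.nHat f n) :
    R.logEuler x - euler _ (x : R.gHat f) ∈ R.nHat f (n + 1) := by
  have := R.adSeries_sub_mem (fun i => expCoeff (i + 1)) x hn hx (degreeScale_mem_tail (fun k => k) hx)
  simp only [zero_add, expCoeff_one, one_smul] at this
  exact tail_mono (by omega) this

/-- The linearization of `logEuler` to leading order is the Euler derivation; this makes the
iteration in `exists_logEuler_eq` a contraction. -/
theorem logEuler_congr {x x' : R.nHat f 1} {a : ℤ} (h : (x : R.gHat f) - x' ∈ R.nHat f a) :
    R.logEuler x - R.logEuler x' - euler _ ((x : R.gHat f) - (x' : R.gHat f)) ∈ R.nHat f (a + 1) := by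
  have := R.adSeries_congr (fun i => expCoeff (i + 1)) (degreeScale_mem_tail (fun k => k) x.2)
    (degreeScale_mem_tail (fun k => k) x'.2) h
    (by rw [← map_sub]; exact degreeScale_mem_tail (fun k => k) h)
  simpa only [zero_add, expCoeff_one, one_smul, map_sub] using this

theorem adExp_sub_mem {x : R.nHat f 1} {y : R.gHat f} {a b : ℤ} (ha : 1 ≤ a)
    (hx : (x : R.gHat f) ∈ R.nHat f a) (hy : y ∈ R.nHat f b) :
    R.adExp x y - y ∈ R.nHat f (b + a) := by
  simpa only [expCoeff_zero, one_smul] using R.adSeries_sub_mem expCoeff x ha hx hy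

/-- The equation `logEuler x = L` can be solved. -/
theorem exists_logEuler_eq {n : ℤ} (hn : 1 ≤ n) {L : R.gHat f} (hL : L ∈ R.nHat f n) :
    ∃ x : R.nHat f 1, (x : R.gHat f) ∈ R.nHat f n ∧ R.logEuler x = L := by
  classical
  let inv := degreeScale (R.gDeg f) fun k => (k : ℂ)⁻¹
  -- The equation is rewritten as e v = L - (logEuler v - e v) and e is inverted. The value 0
  -- outside `nHat f 1` is never reached by the iteration.
  let C : R.gHat f → R.gHat f := fun v =>
    if h : v ∈ R.nHat f 1 then inv (L - (R.logEuler ⟨v, h⟩ - euler _ v)) else 0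
  have hC : ∀ v (h : v ∈ R.nHat f 1), C v = inv (L - (R.logEuler ⟨v, h⟩ - euler _ v)) :=
    fun v h => dif_pos h
  have h1 : ∀ {v}, v ∈ R.nHat f n → v ∈ R.nHat f 1 := fun h => tail_mono hn h
  have hmem : ∀ v (h : v ∈ R.nHat f n),
      L - (R.logEuler ⟨v, h1 h⟩ - euler _ v) ∈ R.nHat f n := fun v h =>
    Submodule.sub_mem _ hL (Submodule.sub_mem _ (R.logEuler_mem (x := ⟨v, h1 h⟩) h)
      (degreeScale_mem_tail _ h))
  obtain ⟨v, hv, hfix⟩ := exists_fixedPoint C n (fun v hv => by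
      rw [hC v (h1 hv)]
      exact degreeScale_mem_tail _ (hmem v hv)) (fun a ha v hv w hw hvw => by
      rw [hC v (h1 hv), hC w (h1 hw), ← map_sub]
      refine degreeScale_mem_tail _ ?_
      have := Submodule.neg_mem _
        (R.logEuler_congr (x := ⟨v, h1 hv⟩) (x' := ⟨w, h1 hw⟩) hvw)
      convert this using 1
      simp only [map_sub]
      abel)
  refine ⟨⟨v, h1 hv⟩, hv, ?_⟩
  rw [hC v (h1 hv)] at hfix
  have h2 := congrArg (euler (R.gDeg f)) hfix
  rw [euler_degreeScale_inv (h1 (hmem v hv)), sub_eq_iff_eq_add, add_sub_cancel] at h2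
  exact h2.symm

end AdSeries

/-! ### Exponentials -/

section Exp

variable (V : Type*) [AddCommGroup V] [Module ℂ V] [LieRingModule R.KacMoody V]
  [LieModule ℂ R.KacMoody V] {f}

theorem isGraded_vDeg : R.IsGraded f (R.vDeg f V) := fun _ _ _ h _ hx _ hv =>
  R.lie_mem_vDeg f h hx hv

/-- Both `rho` and `adHat` are instances of `act`, so its properties serve for V and for the adjoint
action. -/
theorem rho_eq_act : R.rho f V = R.act f (R.isGraded_vDeg V) := rfl

theorem rho_mem_raising {m : ℤ} {x : R.gHat f} (hx : x ∈ R.nHat f m) :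
    R.rho f V x ∈ raising (R.vDeg f V) m := R.rho_raisesBy f hx

theorem rho_adHat_pow (x y : R.gHat f) (i : ℕ) :
    R.rho f V (((R.adHat f x) ^ i) y)
      = ((LieAlgebra.ad ℂ (End ℂ (R.vHat f V)) (R.rho f V x)) ^ i) (R.rho f V y) := by
  induction i with
  | zero => rfl
  | succ i ih =>
    rw [pow_succ', pow_succ', Module.End.mul_apply, Module.End.mul_apply, ← ih,
      LieAlgebra.ad_apply, rho_eq_act, act_adHat]

theorem hasProSum_rho_adSeries (c : ℕ → ℂ) (x : R.nHat f 1) {y : R.gHat f}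
    (hy : y ∈ R.nHat f 0) :
    HasProSum (fun i => c i • ((LieAlgebra.ad ℂ (End ℂ (R.vHat f V)) (R.rho f V x)) ^ i)
      (R.rho f V y)) (R.rho f V (R.adSeries c x y)) := by
  intro N
  have := R.rho_mem_raising V (R.adSeries_sub_sum_mem c x le_rfl x.2 hy N)
  simpa only [map_sub, map_sum, map_smul, rho_adHat_pow, mul_one, zero_add] using this

theorem coe_expRho (x : R.nHat f 1) : (R.expRho f V x : End ℂ (R.vHat f V))
    = expEnd le_rfl (R.rho f V x) (R.rho_raisesBy f x.2) := rfl

theorem expRho_mul_rho (x : R.nHat f 1) {y : R.gHat f} (hy : y ∈ R.nHat f 0) :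
    (R.expRho f V x : End ℂ (R.vHat f V)) * R.rho f V y
      = R.rho f V (R.adExp x y) * (R.expRho f V x : End ℂ (R.vHat f V)) :=
  expEnd_mul_eq (R.rho_raisesBy f x.2) (R.rho_mem_raising V hy) (R.hasProSum_rho_adSeries V expCoeff x hy)

/-- With X = ρ(x), exp(X) e exp(-X) = exp(ad X) e. Since ad X sends e to -ρ(e x), the terms after
the first form the series with coefficients 1/(i+1)! applied to -ρ(e x), that is -ρ(logEuler x). -/
theorem lie_euler_expRho (x : R.nHat f 1) :
    ⁅euler (R.vDeg f V), (R.expRho f V x : End ℂ (R.vHat f V))⁆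
      = R.rho f V (R.logEuler x) * (R.expRho f V x : End ℂ (R.vHat f V)) := by
  have h0 : euler _ (x : R.gHat f) ∈ R.nHat f 1 := degreeScale_mem_tail _ x.2
  have key := expEnd_mul_eq (Y := euler (R.vDeg f V))
    (Y' := euler (R.vDeg f V) + -R.rho f V (R.logEuler x)) (R.rho_raisesBy f x.2)
    (degreeScale_mem_raising _) <|
    (R.hasProSum_rho_adSeries V (fun i => expCoeff (i + 1)) x
      (tail_mono (by omega) h0)).neg.cons (degreeScale_mem_raising _) (fun i => by
        refine Submodule.neg_mem _ (Submodule.smul_mem _ _ ?_)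
        rw [← rho_adHat_pow]
        have := R.rho_mem_raising V (R.adHat_pow_mem x.2 h0 i)
        rwa [add_comm] at this) (by simp [expCoeff_zero]) (fun i => by
        rw [pow_succ, Module.End.mul_apply, LieAlgebra.ad_apply, ← lie_skew, rho_eq_act,
          lie_euler_act, map_neg, smul_neg])
  rw [coe_expRho, Ring.lie_def, key]
  exact (by
    intro B _ a b c
    rw [← sub_eq_add_neg, sub_mul, sub_sub_cancel] : ∀ {B : Type _} [Ring B] (a b c : B),
    a * c - (a + -b) * c = b * c) _ _ _

theorem expRho_sub_one_mem {x : R.nHat f 1} {n : ℤ} (hn : 1 ≤ n)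
    (hx : (x : R.gHat f) ∈ R.nHat f n) :
    (R.expRho f V x : End ℂ (R.vHat f V)) - 1 ∈ raising (R.vDeg f V) n :=
  expEnd_sub_one le_rfl hn _ (R.rho_raisesBy f x.2) (R.rho_raisesBy f hx)

theorem expRho_inv (x : R.nHat f 1) : (R.expRho f V x)⁻¹ = R.expRho f V (-x) := by
  rw [inv_eq_iff_mul_eq_one]
  refine Units.ext ?_
  rw [Units.val_mul, Units.val_one, coe_expRho, coe_expRho]
  have h : R.rho f V ((-x : R.nHat f 1) : R.gHat f) = -R.rho f V x := by
    rw [← map_neg]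
    rfl
  have h' : RaisesBy 1 (-R.rho f V x) := h ▸ R.rho_raisesBy f (-x).2
  rw [← expEnd_mul_expEnd_neg (R.rho_raisesBy f x.2) h']
  congr 1
  simp only [h]

theorem expRho_conj (x y : R.nHat f 1) :
    R.expRho f V x * R.expRho f V y * (R.expRho f V x)⁻¹
      = R.expRho f V ⟨R.adExp x y, R.adSeries_mem _ x y.2⟩ := by
  rw [mul_inv_eq_iff_eq_mul]
  refine Units.ext ?_
  rw [Units.val_mul, Units.val_mul]
  refine expEnd_intertwine ?_ (R.rho_raisesBy f y.2)
    (R.rho_raisesBy f (R.adSeries_mem _ x y.2)) (R.expRho_mul_rho V x (tail_mono (by omega) y.2))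
  have := Submodule.add_mem _ (raising_mono (by omega) (R.expRho_sub_one_mem V le_rfl x.2))
    (one_mem_raising (W := R.vDeg f V))
  rwa [sub_add_cancel] at this

end Exp

end Realization

namespace Realization

variable {ℓ : ℕ} {A : Matrix (Fin ℓ) (Fin ℓ) ℤ} {𝔥 : Type*} [AddCommGroup 𝔥] [Module ℂ 𝔥]
  (R : Realization A 𝔥) {P : AddSubgroup (Dual ℂ 𝔥)} {f : P →+ ℤ}
  (V : Type*) [AddCommGroup V] [Module ℂ V] [LieRingModule R.KacMoody V]
  [LieModule ℂ R.KacMoody V]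

attribute [local instance] completionAddCommGroup LieRing.ofAssociativeRing

/-! ### Logarithmic Euler derivatives -/

/-- `g` is unipotent with logarithmic Euler derivative `ρ(L)`. -/
structure IsLogDeriv (g : LinearMap.GeneralLinearGroup ℂ (R.vHat f V)) (L : R.gHat f) : Prop where
  sub_one : (g : End ℂ (R.vHat f V)) - 1 ∈ raising (R.vDeg f V) 1
  lie_euler : ⁅euler (R.vDeg f V), (g : End ℂ (R.vHat f V))⁆
    = R.rho f V L * (g : End ℂ (R.vHat f V))

theorem isLogDeriv_expRho (x : R.nHat f 1) : R.IsLogDeriv V (R.expRho f V x) (R.logEuler x) :=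
  ⟨R.expRho_sub_one_mem V le_rfl x.2, R.lie_euler_expRho V x⟩

theorem isLogDeriv_one : R.IsLogDeriv V (1 : LinearMap.GeneralLinearGroup ℂ (R.vHat f V)) 0 where
  sub_one := by
    rw [Units.val_one, sub_self]
    exact Submodule.zero_mem _
  lie_euler := by
    rw [Units.val_one, Ring.lie_def, mul_one, one_mul, sub_self, map_zero, zero_mul]

variable {V}

theorem IsLogDeriv.mem_raising_zero {g : LinearMap.GeneralLinearGroup ℂ (R.vHat f V)}
    {L : R.gHat f} (h : R.IsLogDeriv V g L) :
    (g : End ℂ (R.vHat f V)) ∈ raising (R.vDeg f V) 0 := by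
  have := Submodule.add_mem _ (raising_mono (by omega) h.sub_one)
    (one_mem_raising (W := R.vDeg f V))
  rwa [sub_add_cancel] at this

/-- The Leibniz rule gives two terms; in the second, ρ(L) is moved to the left of exp(ρ(x)) and
becomes ρ(exp(ad x) L). -/
theorem IsLogDeriv.expRho_mul {g : LinearMap.GeneralLinearGroup ℂ (R.vHat f V)} {L : R.gHat f}
    (h : R.IsLogDeriv V g L) (hL : L ∈ R.nHat f 0) (x : R.nHat f 1) :
    R.IsLogDeriv V (R.expRho f V x * g) (R.logEuler x + R.adExp x L) where
  sub_one := by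
    rw [Units.val_mul]
    have h1 := mul_mem_raising (add_zero 1) (R.expRho_sub_one_mem V le_rfl x.2) h.mem_raising_zero
    have := Submodule.add_mem _ h1 h.sub_one
    rwa [sub_mul, one_mul, sub_add_sub_cancel] at this
  lie_euler := by
    have h1 := R.lie_euler_expRho V x
    have h2 := h.lie_euler
    have h3 := R.expRho_mul_rho V x hL
    rw [Units.val_mul, map_add]
    generalize (R.expRho f V x : End ℂ (R.vHat f V)) = E at *
    generalize (g : End ℂ (R.vHat f V)) = G at *
    have h4 : ⁅euler (R.vDeg f V), E * G⁆
        = ⁅euler (R.vDeg f V), E⁆ * G + E * ⁅euler (R.vDeg f V), G⁆ := by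
      simp only [Ring.lie_def, sub_mul, mul_sub, mul_assoc]
      abel
    rw [h4, h1, h2, ← mul_assoc E, h3, add_mul, mul_assoc, mul_assoc]

/-- An operator is an exponential as soon as its logarithmic derivative comes from `n̂⁺_n`. -/
theorem IsLogDeriv.exists_eq_expRho {g : LinearMap.GeneralLinearGroup ℂ (R.vHat f V)}
    {L : R.gHat f} (h : R.IsLogDeriv V g L) {n : ℤ} (hn : 1 ≤ n) (hL : L ∈ R.nHat f n) :
    ∃ x : R.nHat f 1, (x : R.gHat f) ∈ R.nHat f n ∧ R.logEuler x = L ∧ g = R.expRho f V x := by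
  obtain ⟨x, hx, rfl⟩ := R.exists_logEuler_eq hn hL
  refine ⟨x, hx, rfl, Units.ext ?_⟩
  have hx' := R.isLogDeriv_expRho V x
  exact eq_of_lie_euler h.sub_one hx'.sub_one (R.rho_mem_raising V (tail_mono hn hL))
    h.lie_euler hx'.lie_euler

/-- Since `logEuler x` agrees with e x to leading order and e is injective in positive degrees, the
leading term of x can be read off from its logarithmic derivative. -/
theorem sub_mem_of_logEuler_sub_mem {z w : R.gHat f} {x : R.nHat f 1} {n : ℤ} (hn : 1 ≤ n)
    (hx : (x : R.gHat f) ∈ R.nHat f n) (hz : R.logEuler x = z) (hw : w ∈ R.nHat f 1)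
    (h : z - euler _ w ∈ R.nHat f (n + 1)) : (x : R.gHat f) - w ∈ R.nHat f (n + 1) := by
  subst hz
  refine mem_tail_of_euler_mem (Submodule.sub_mem _ x.2 hw) ?_
  have := Submodule.sub_mem _ h (R.logEuler_sub_mem hn hx)
  rwa [sub_sub_sub_cancel_left, ← map_sub] at this

/-! ### Products, conjugates and commutators of exponentials to leading order -/

variable (V)

/-- Multiplication of exponentials to leading order. -/
theorem expRho_mul_expRho {n : ℤ} (hn : 1 ≤ n) {x y : R.nHat f 1}
    (hx : (x : R.gHat f) ∈ R.nHat f n) (hy : (y : R.gHat f) ∈ R.nHat f n) :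
    ∃ z : R.nHat f 1, (z : R.gHat f) ∈ R.nHat f n ∧
      (z : R.gHat f) - ((x : R.gHat f) + (y : R.gHat f)) ∈ R.nHat f (n + 1) ∧
      R.expRho f V x * R.expRho f V y = R.expRho f V z := by
  have hly := R.logEuler_mem hy
  obtain ⟨z, hz, hlog, heq⟩ :=
    ((R.isLogDeriv_expRho V y).expRho_mul R (tail_mono (by omega) hly) x).exists_eq_expRho R hn
      (Submodule.add_mem _ (R.logEuler_mem hx) (R.adSeries_mem _ x hly))
  refine ⟨z, hz, R.sub_mem_of_logEuler_sub_mem hn hz hlog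
    (tail_mono hn (Submodule.add_mem _ hx hy)) ?_, heq⟩
  have h1 := R.logEuler_sub_mem hn hx
  have h2 := R.logEuler_sub_mem hn hy
  have h3 := tail_mono (show n + 1 ≤ n + n by omega) (R.adExp_sub_mem hn hx hly)
  have := Submodule.add_mem _ (Submodule.add_mem _ h1 h2) h3
  convert this using 1
  rw [map_add]
  abel

/-- The group `exp(ρ(n̂⁺_n))`. -/
def expGroup (n : ℤ) (hn : 1 ≤ n) : Subgroup (LinearMap.GeneralLinearGroup ℂ (R.vHat f V)) where
  carrier := {g | ∃ x : R.nHat f 1, (x : R.gHat f) ∈ R.nHat f n ∧ g = R.expRho f V x}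
  mul_mem' := by
    rintro _ _ ⟨x, hx, rfl⟩ ⟨y, hy, rfl⟩
    obtain ⟨z, hz, -, h⟩ := R.expRho_mul_expRho V hn hx hy
    exact ⟨z, hz, h⟩
  one_mem' := by
    obtain ⟨x, hx, -, h⟩ := (R.isLogDeriv_one V (f := f)).exists_eq_expRho R hn
      (Submodule.zero_mem _)
    exact ⟨x, hx, h⟩
  inv_mem' := by
    rintro _ ⟨x, hx, rfl⟩
    exact ⟨-x, Submodule.neg_mem _ hx, R.expRho_inv V x⟩

variable {V}

theorem expGroup_mono {n k : ℤ} (hn : 1 ≤ n) (h : n ≤ k) :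
    R.expGroup V k (hn.trans h) (f := f) ≤ R.expGroup V n hn := by
  rintro _ ⟨x, hx, rfl⟩
  exact ⟨x, tail_mono h hx, rfl⟩

variable (V)

theorem expRho_conj_mem {n : ℤ} (hn : 1 ≤ n) (x : R.nHat f 1)
    {g : LinearMap.GeneralLinearGroup ℂ (R.vHat f V)} (hg : g ∈ R.expGroup V n hn) :
    R.expRho f V x * g * (R.expRho f V x)⁻¹ ∈ R.expGroup V n hn := by
  obtain ⟨y, hy, rfl⟩ := hg
  exact ⟨_, R.adSeries_mem _ x hy, R.expRho_conj V x y⟩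

/-- This converts congruence of exponents into equality of cosets. -/
theorem expRho_inv_mul_mem {n : ℤ} (hn : 1 ≤ n) {x y : R.nHat f 1}
    (hx : (x : R.gHat f) ∈ R.nHat f n) (hy : (y : R.gHat f) ∈ R.nHat f n)
    (h : (x : R.gHat f) - y ∈ R.nHat f (n + 1)) :
    (R.expRho f V x)⁻¹ * R.expRho f V y ∈ R.expGroup V (n + 1) (by omega) := by
  rw [expRho_inv]
  obtain ⟨z, -, hz, heq⟩ := R.expRho_mul_expRho V hn (x := -x) (Submodule.neg_mem _ hx) hy
  refine ⟨z, ?_, heq⟩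
  have := Submodule.sub_mem _ hz h
  convert this using 1
  rw [Submodule.coe_neg]
  abel

/-- `exp(ρ(y + u)) exp(ρ(y))⁻¹` to leading order, for homogeneous `y`. -/
theorem expRho_mul_expRho_inv {k : ℤ} {y z : R.nHat f 1} {m : ℤ} (a : R.gDeg f m)
    (hm : 1 ≤ m) (hk : 1 ≤ k) (hy : (y : R.gHat f) = single m a)
    (hu : (z : R.gHat f) - y ∈ R.nHat f k) :
    ∃ w : R.nHat f 1, (w : R.gHat f) ∈ R.nHat f k ∧
      (w : R.gHat f) - ((z : R.gHat f) - (y : R.gHat f)) ∈ R.nHat f (k + 1) ∧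
      R.expRho f V z * (R.expRho f V y)⁻¹ = R.expRho f V w := by
  -- As y is homogeneous of degree m, [y, y] = 0 and e y = m y. Every series in ad y applied to a
  -- multiple of y reduces to its constant term, so `logEuler` sends ±y to ±m y.
  have hyy : R.adHat f y y = 0 := by
    rw [hy, adHat_single_single]
    ext j
    rcases eq_or_ne j (m + m) with rfl | h
    · rw [single_apply_same]
      exact lie_self _
    · exact single_apply_ne h _
  have hey : euler _ (y : R.gHat f) = (m : ℂ) • (y : R.gHat f) := by
    rw [hy]
    ext j
    rcases eq_or_ne j m with rfl | h
    · rfl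
    · rw [degreeScale_apply, Submodule.coe_smul, Pi.smul_apply, single_apply_ne h, smul_zero,
        smul_zero]
  have hser : ∀ (c : ℕ → ℂ) (s : ℂ), R.adSeries c y (s • (y : R.gHat f)) = c 0 • s • (y : R.gHat f) :=
    fun c s => R.adSeries_of_adHat_eq_zero c (by rw [map_smul, hyy, smul_zero])
  have hlogy : R.logEuler y = (m : ℂ) • (y : R.gHat f) := by
    rw [logEuler, hey, hser, zero_add, expCoeff_one, one_smul]
  have hlogn : R.logEuler (-y) = -((m : ℂ) • (y : R.gHat f)) := by
    have h0 : euler _ ((-y : R.nHat f 1) : R.gHat f) = -((m : ℂ) • (y : R.gHat f)) := by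
      rw [Submodule.coe_neg, map_neg, hey]
    rw [logEuler, h0, adSeries_of_adHat_eq_zero, zero_add, expCoeff_one, one_smul]
    rw [Submodule.coe_neg, map_neg, map_neg, LinearMap.neg_apply, map_smul, hyy, smul_zero,
      neg_zero, neg_zero]
  have hmy : (m : ℂ) • (y : R.gHat f) ∈ R.nHat f 1 := Submodule.smul_mem _ _ y.2
  -- Both terms are compared with their values at z = y, where they cancel. The errors are then
  -- measured by the order k of z - y rather than by the order of y.
  have h1 := R.logEuler_congr hu
  have h2 := R.adSeries_congr expCoeff (x := z) (x' := y) hmy hmy hu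
    (by rw [sub_self]; exact Submodule.zero_mem _)
  rw [hser, expCoeff_zero, one_smul, sub_self, smul_zero, sub_zero] at h2
  have hneg : R.adExp z (-((m : ℂ) • (y : R.gHat f))) = -R.adExp z ((m : ℂ) • (y : R.gHat f)) :=
    map_neg _ _
  have key : R.logEuler z + R.adExp z (R.logEuler (-y)) - euler _ ((z : R.gHat f) - (y : R.gHat f))
      ∈ R.nHat f (k + 1) := by
    have := Submodule.sub_mem _ h1 h2
    rw [hlogn, hneg]
    rw [hlogy] at this
    convert this using 1
    abel
  have hmem : R.logEuler z + R.adExp z (R.logEuler (-y)) ∈ R.nHat f k := by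
    have := Submodule.add_mem _ (tail_mono (show k ≤ k + 1 by omega) key)
      (degreeScale_mem_tail (fun j => j) hu)
    rwa [sub_add_cancel] at this
  rw [expRho_inv]
  obtain ⟨w, hw, hlog, heq⟩ := ((R.isLogDeriv_expRho V (-y)).expRho_mul R
    (tail_mono (by omega) (R.logEuler_mem (-y).2)) z).exists_eq_expRho R hk hmem
  exact ⟨w, hw, R.sub_mem_of_logEuler_sub_mem hk hw hlog (tail_mono hk hu) key, heq⟩

/-- The commutator of exponentials of homogeneous elements to leading order. -/
theorem commutator_expRho {n m : ℤ} (hn : 1 ≤ n) (hm : 1 ≤ m) {x y : R.nHat f 1}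
    (a : R.gDeg f n) (b : R.gDeg f m) (hx : (x : R.gHat f) = single n a)
    (hy : (y : R.gHat f) = single m b) :
    ∃ w : R.nHat f 1, (w : R.gHat f) ∈ R.nHat f (n + m) ∧
      (w : R.gHat f) - R.adHat f x y ∈ R.nHat f (n + m + 1) ∧
      R.expRho f V x * R.expRho f V y * (R.expRho f V x)⁻¹ * (R.expRho f V y)⁻¹
        = R.expRho f V w := by
  have hxn : (x : R.gHat f) ∈ R.nHat f n := hx ▸ single_mem_tail n a
  have hym : (y : R.gHat f) ∈ R.nHat f m := hy ▸ single_mem_tail m b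
  -- Keeping y + [x, y] in exp(ad x) y leaves a remainder of degree at least m + 2n, hence at least
  -- n + m + 1.
  have h2 := R.adSeries_sub_sum_mem expCoeff x hn hxn hym 2
  rw [Finset.sum_range_succ, Finset.sum_range_one, expCoeff_zero, expCoeff_one, one_smul, one_smul,
    pow_zero, pow_one, Module.End.one_apply, ← sub_sub] at h2
  have h3 : R.adExp x y - (y : R.gHat f) - R.adHat f x y ∈ R.nHat f (n + m + 1) :=
    tail_mono (by push_cast; omega) h2
  have h1 : R.adExp x y - (y : R.gHat f) ∈ R.nHat f (n + m) := by
    have := R.adExp_sub_mem hn hxn hym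
    rwa [add_comm] at this
  rw [expRho_conj]
  obtain ⟨w, hw, hw', heq⟩ := R.expRho_mul_expRho_inv V
    (z := ⟨R.adExp x y, R.adSeries_mem _ x y.2⟩) b hm (show 1 ≤ n + m by omega) hy h1
  refine ⟨w, hw, ?_, heq⟩
  have := Submodule.add_mem _ hw' h3
  rwa [sub_add_sub_cancel] at this

end Realization

theorem lcoset_eq_lcoset {G : Type*} [Group G] (K : Subgroup G) {g h : G} (hgh : g⁻¹ * h ∈ K) :
    lcoset g (K : Set G) = lcoset h (K : Set G) := by
  ext a
  constructor
  · rintro ⟨u, hu, rfl⟩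
    exact ⟨h⁻¹ * g * u, K.mul_mem (by simpa using K.inv_mem hgh) hu, by group⟩
  · rintro ⟨u, hu, rfl⟩
    exact ⟨g⁻¹ * h * u, K.mul_mem hgh hu, by group⟩

namespace Realization

variable {ℓ : ℕ} {A : Matrix (Fin ℓ) (Fin ℓ) ℤ} {𝔥 : Type*} [AddCommGroup 𝔥] [Module ℂ 𝔥]
  (R : Realization A 𝔥) {P : AddSubgroup (Dual ℂ 𝔥)} {f : P →+ ℤ}
  (V : Type*) [AddCommGroup V] [Module ℂ V] [LieRingModule R.KacMoody V]
  [LieModule ℂ R.KacMoody V]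

attribute [local instance] completionAddCommGroup LieRing.ofAssociativeRing

/-! ### Infinite products -/

theorem coe_homog (k : ℕ) (hk : 1 ≤ k) (x : R.gDeg f k) :
    (R.homog f k hk x : R.gHat f) = single (k : ℤ) x := rfl

theorem partialProd_mem_raising (n : ℕ) (hn : 1 ≤ n) (x : ∀ k : ℕ, R.gDeg f k) (N : ℕ) :
    (R.partialProd f V n hn x N : End ℂ (R.vHat f V)) ∈ raising (R.vDeg f V) 0 := by
  intro k v hv
  rw [add_zero]
  exact R.partialProd_mem f V n hn x N k v hv

theorem partialProd_sub_mem_raising (n : ℕ) (hn : 1 ≤ n) (x : ∀ k : ℕ, R.gDeg f k) (N j : ℕ) :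
    (R.partialProd f V n hn x (N + j) : End ℂ (R.vHat f V))
      - (R.partialProd f V n hn x N : End ℂ (R.vHat f V)) ∈ raising (R.vDeg f V) (n + N) := by
  induction j with
  | zero =>
    rw [add_zero, sub_self]
    exact Submodule.zero_mem _
  | succ j ih =>
    have h1 := raising_mono (show (n + N : ℤ) ≤ n + (N + j : ℕ) by push_cast; omega)
      (mul_mem_raising (add_zero _) (R.partialProd_step f V n hn x (N + j))
        (R.partialProd_mem_raising V n hn x (N + j)))
    have := Submodule.add_mem _ h1 ih
    rw [← add_assoc, partialProd, Units.val_mul]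
    rwa [sub_mul, one_mul, sub_add_sub_cancel] at this

theorem infProd_sub_partialProd_mem_raising (n : ℕ) (hn : 1 ≤ n) (x : ∀ k : ℕ, R.gDeg f k)
    (N : ℕ) : (R.infProd f V n hn x : End ℂ (R.vHat f V))
      - (R.partialProd f V n hn x N : End ℂ (R.vHat f V)) ∈ raising (R.vDeg f V) (n + N) := by
  intro k v hv j hj
  obtain ⟨N', hN', hle⟩ := ((coordLimit_eventually _ (R.partialProd_mem f V n hn x)
    (R.partialProd_stable f V n hn x) v j).and (Filter.eventually_ge_atTop N)).exists
  obtain ⟨i, rfl⟩ := Nat.exists_eq_add_of_le hle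
  have := R.partialProd_sub_mem_raising V n hn x N i k v hv j hj
  rw [LinearMap.sub_apply, Submodule.coe_sub, Pi.sub_apply] at this ⊢
  rw [← this]
  exact congrArg (· - _) hN'.symm

/-- The logarithmic derivatives of the partial products. -/
def partialLog (n : ℕ) (hn : 1 ≤ n) (x : ∀ k : ℕ, R.gDeg f k) : ℕ → R.gHat f
  | 0 => 0
  | N + 1 => R.logEuler (R.homog f (n + N) (by omega) (x (n + N)))
      + R.adExp (R.homog f (n + N) (by omega) (x (n + N))) (partialLog n hn x N)

theorem partialLog_mem (n : ℕ) (hn : 1 ≤ n) (x : ∀ k : ℕ, R.gDeg f k) (N : ℕ) :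
    R.partialLog n hn x N ∈ R.nHat f n := by
  induction N with
  | zero => exact Submodule.zero_mem _
  | succ N ih =>
    exact Submodule.add_mem _ (R.logEuler_mem (tail_mono (by push_cast; omega)
      (R.homog_mem f (n + N) (by omega) (x (n + N))))) (R.adSeries_mem _ _ ih)

theorem isLogDeriv_partialProd (n : ℕ) (hn : 1 ≤ n) (x : ∀ k : ℕ, R.gDeg f k) (N : ℕ) :
    R.IsLogDeriv V (R.partialProd f V n hn x N) (R.partialLog n hn x N) := by
  induction N with
  | zero => exact R.isLogDeriv_one V
  | succ N ih => exact ih.expRho_mul R (tail_mono (by omega) (R.partialLog_mem n hn x N)) _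

/-- The new factor has degree n + N, so neither its own `logEuler` nor its adjoint exponential
affects lower degrees. -/
theorem partialLog_succ_sub_mem (n : ℕ) (hn : 1 ≤ n) (x : ∀ k : ℕ, R.gDeg f k) (N : ℕ) :
    R.partialLog n hn x (N + 1) - R.partialLog n hn x N ∈ R.nHat f (n + N) := by
  have h := R.homog_mem f (n + N) (by omega) (x (n + N))
  push_cast at h
  have h1 := R.logEuler_mem h
  have h2 := tail_mono (show (n + N : ℤ) ≤ n + (n + N) by omega)
    (R.adExp_sub_mem (by omega) h (R.partialLog_mem n hn x N))
  have := Submodule.add_mem _ h1 h2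
  rwa [← add_sub_assoc] at this

/-- The logarithmic derivatives of the partial products converge to some L, and the defining
equation passes to the limit. -/
theorem infProd_mem_expGroup (n : ℕ) (hn : 1 ≤ n) (x : ∀ k : ℕ, R.gDeg f k) :
    R.infProd f V n hn x ∈ R.expGroup V n (by omega) := by
  obtain ⟨L, hL⟩ := exists_limit (R.partialLog n hn x) n (R.partialLog_succ_sub_mem n hn x)
  have hLn : L ∈ R.nHat f n := by
    have := Submodule.add_mem _ (hL 0) (tail_mono (by simp) (R.partialLog_mem n hn x 0))
    rw [sub_add_cancel] at this
    simpa using this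
  have hlog : R.IsLogDeriv V (R.infProd f V n hn x) L := by
    refine ⟨R.infProdEnd_sub_one f V n hn x, sub_eq_zero.mp
      (eq_zero_of_forall_raising fun N => raising_mono (show (N : ℤ) ≤ n + N by omega) ?_)⟩
    have h1 := R.infProd_sub_partialProd_mem_raising V n hn x N
    have h2 := R.rho_mem_raising V (hL N)
    have h3 := (R.isLogDeriv_partialProd V n hn x N).lie_euler
    have h4 := R.rho_mem_raising V (tail_mono (show (0 : ℤ) ≤ n by omega) hLn)
    have h5 := R.partialProd_mem_raising V n hn x N
    rw [map_sub] at h2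
    generalize (R.infProd f V n hn x : End ℂ (R.vHat f V)) = I at *
    generalize (R.partialProd f V n hn x N : End ℂ (R.vHat f V)) = Q at *
    generalize R.rho f V L = S at *
    generalize R.rho f V (R.partialLog n hn x N) = T at *
    have he := degreeScale_mem_raising (W := R.vDeg f V) fun k => k
    -- The defect [e, I] - S I equals e(I - Q) - (I - Q)e - (S - T)Q - S(I - Q), because [e, Q] = T
    -- Q.
    have h6 := Submodule.sub_mem _ (Submodule.sub_mem _ (Submodule.sub_mem _
      (mul_mem_raising (zero_add _) he h1) (mul_mem_raising (add_zero _) h1 he))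
      (mul_mem_raising (add_zero _) h2 h5)) (mul_mem_raising (zero_add _) h4 h1)
    convert h6 using 1
    rw [Ring.lie_def, sub_eq_iff_eq_add] at h3
    simp only [Ring.lie_def, mul_sub, sub_mul, h3]
    abel
  obtain ⟨z, hz, -, heq⟩ := hlog.exists_eq_expRho R (by omega) hLn
  exact ⟨z, hz, heq⟩

/-- Multiplying by exp(-ρ(z_k)) kills the leading component. It is done on the right because the
infinite products grow to the left. -/
theorem exists_expRho_eq_mul_homog (k : ℕ) (hk : 1 ≤ k) (z : R.nHat f 1)
    (hz : (z : R.gHat f) ∈ R.nHat f k) :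
    ∃ z' : R.nHat f 1, (z' : R.gHat f) ∈ R.nHat f (k + 1 : ℕ) ∧
      R.expRho f V z = R.expRho f V z' *
        R.expRho f V (R.homog f k hk ⟨(z : ℤ → R.KacMoody) k, z.1.2.1 k⟩) := by
  obtain ⟨w, -, hw', heq⟩ := R.expRho_mul_expRho V (by omega) hz
    (y := -R.homog f k hk ⟨(z : ℤ → R.KacMoody) k, z.1.2.1 k⟩)
    (Submodule.neg_mem _ (R.homog_mem f k hk _))
  refine ⟨w, ?_, ?_⟩
  · have := Submodule.add_mem _ hw' (sub_lead_mem_tail hz)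
    push_cast
    convert this using 1
    rw [Submodule.coe_neg, coe_homog, lead]
    abel
  · rw [← heq, ← expRho_inv, inv_mul_cancel_right]

theorem exists_eq_infProd (n : ℕ) (hn : 1 ≤ n)
    {g : LinearMap.GeneralLinearGroup ℂ (R.vHat f V)} (hg : g ∈ R.expGroup V n (by omega)) :
    ∃ x : ∀ k : ℕ, R.gDeg f k, g = R.infProd f V n hn x := by
  obtain ⟨z, hz, rfl⟩ := hg
  choose! next hnext hmul using R.exists_expRho_eq_mul_homog V (f := f)
  -- Here `s N` is the exponent left after N factors have been split off, and `x k` below is its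
  -- leading component at stage k - n. Values of `x k` for k < n play no role.
  let s : ℕ → R.nHat f 1 := fun N => N.rec z fun j w => next (n + j) w
  have hs : ∀ N : ℕ, (s N).1 ∈ R.nHat f (n + N : ℕ) := by
    intro N
    induction N with
    | zero => exact hz
    | succ N ih => exact hnext (n + N) (by omega) _ ih
  let x : ∀ k : ℕ, R.gDeg f k := fun k => ⟨((s (k - n)).1 : ℤ → R.KacMoody) k, (s (k - n)).1.2.1 k⟩
  have hx : ∀ N, R.expRho f V z = R.expRho f V (s N) * R.partialProd f V n hn x N := by
    intro N
    induction N with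
    | zero => exact (mul_one _).symm
    | succ N ih =>
      rw [ih, hmul (n + N) (by omega) _ (hs N), partialProd, ← mul_assoc]
      congr 4
      refine Subtype.ext ?_
      simp only [x]
      rw [Nat.add_sub_cancel_left]
  refine ⟨x, Units.ext (sub_eq_zero.mp (eq_zero_of_forall_raising fun N =>
    raising_mono (show (N : ℤ) ≤ n + N by omega) ?_))⟩
  -- Both exp(ρ(z)) and the infinite product differ from the Nth partial product by operators
  -- raising degrees by n + N.
  have h1 := R.infProd_sub_partialProd_mem_raising V n hn x N
  have h2 := R.expRho_sub_one_mem V (by omega) (hs N)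
  push_cast at h2
  have h3 := mul_mem_raising (add_zero _) h2 (R.partialProd_mem_raising V n hn x N)
  have := Submodule.sub_mem _ h3 h1
  rw [hx N, Units.val_mul]
  rwa [sub_mul, one_mul, sub_sub_sub_cancel_right] at this

theorem UHat_eq_expGroup (n : ℕ) (hn : 1 ≤ n) :
    R.UHat f V n hn = (R.expGroup V n (by omega) (f := f) : Set _) := by
  ext g
  constructor
  · rintro ⟨x, rfl⟩
    exact R.infProd_mem_expGroup V n hn x
  · exact R.exists_eq_infProd V n hn

theorem UHat_succ_eq_expGroup (n : ℕ) (hn : 1 ≤ n) :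
    R.UHat f V (n + 1) (by omega) = (R.expGroup V (n + 1) (by omega) (f := f) : Set _) :=
  R.UHat_eq_expGroup V (n + 1) (by omega)

theorem mem_expGroup_iff_exists_incl (n : ℕ) (hn : 1 ≤ n)
    {g : LinearMap.GeneralLinearGroup ℂ (R.vHat f V)} :
    g ∈ R.expGroup V n (by omega) ↔ ∃ x : R.nHat f n, R.expRho f V (R.incl f n hn x) = g := by
  constructor
  · rintro ⟨x, hx, rfl⟩
    exact ⟨⟨x, hx⟩, rfl⟩
  · rintro ⟨x, rfl⟩
    exact ⟨_, x.2, rfl⟩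

/-! ### Faithful modules -/

variable {V}

theorem iSup_vDeg_eq_top (hV : R.IsWeightModule V) (hwts : R.wts V ⊆ P) :
    ⨆ k, R.vDeg f V k = ⊤ := by
  classical
  rw [eq_top_iff, ← hV.isInternal.submodule_iSup_eq_top, iSup_le_iff]
  intro μ
  by_cases h : R.weightSpace V μ = ⊥
  · rw [h]
    exact bot_le
  · refine le_trans ?_ (le_iSup _ (f ⟨μ, hwts h⟩))
    exact le_iSup₂_of_le μ ⟨h, hwts h, rfl⟩ le_rfl

/-- On a homogeneous vector the component of ρ(x)v that is n degrees higher is x_n · v. So x_n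
annihilates every V_k, hence V, and faithfulness gives x_n = 0. -/
theorem mem_nHat_of_rho_mem_raising (hV : R.IsWeightModule V) (hwts : R.wts V ⊆ P)
    [LieModule.IsFaithful ℂ R.KacMoody V] {n : ℤ} {x : R.gHat f} (hx : x ∈ R.nHat f n)
    (h : R.rho f V x ∈ raising (R.vDeg f V) (n + 1)) : x ∈ R.nHat f (n + 1) := by
  intro j hj
  rcases lt_or_ge j n with h1 | h1
  · exact hx j h1
  obtain rfl : j = n := by omega
  have key : ∀ v : V, ⁅(x : ℤ → R.KacMoody) j, v⁆ = 0 := by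
    intro v
    have hv : v ∈ ⨆ k, R.vDeg f V k := R.iSup_vDeg_eq_top hV hwts ▸ Submodule.mem_top
    induction hv using Submodule.iSup_induction' with
    | zero => exact lie_zero _
    | add a b _ _ ha hb => rw [lie_add, ha, hb, add_zero]
    | mem k v hv =>
      have h2 := h k _ (single_mem_tail k ⟨v, hv⟩) (k + j) (by omega)
      rw [rho_eq_act, act_apply, finsum_eq_single _ j, add_sub_cancel_right,
        single_apply_same] at h2
      · exact h2
      · intro i hi
        rw [single_apply_ne (by omega), lie_zero]
  exact LieModule.ext_of_isFaithful (R := ℂ) V fun v => by rw [key, zero_lie]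

/-- The quadratic and higher terms of exp(ρ(x)) raise degrees by 2n ≥ n + 1, so the condition on
exp(ρ(x)) passes to ρ(x). -/
theorem mem_nHat_of_expRho_mem (hV : R.IsWeightModule V) (hwts : R.wts V ⊆ P)
    [LieModule.IsFaithful ℂ R.KacMoody V] {n : ℤ} (hn : 1 ≤ n) {x : R.nHat f 1}
    (hx : (x : R.gHat f) ∈ R.nHat f n)
    (h : R.expRho f V x ∈ R.expGroup V (n + 1) (by omega)) :
    (x : R.gHat f) ∈ R.nHat f (n + 1) := by
  obtain ⟨w, hw, heq⟩ := h
  refine R.mem_nHat_of_rho_mem_raising hV hwts hx ?_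
  have h1 := R.expRho_sub_one_mem V (by omega) hw
  rw [← heq] at h1
  change series expCoeff (R.rho f V x) (R.rho_raisesBy f x.2) - 1 ∈ _ at h1
  have h2 := raising_mono (show n + 1 ≤ (2 : ℕ) * n by push_cast; omega)
    (series_sub_mem expCoeff (T := R.rho f V x) (R.rho_raisesBy f x.2) hn (R.rho_raisesBy f hx) 2)
  rw [Finset.sum_range_succ, Finset.sum_range_one, expCoeff_zero, expCoeff_one, one_smul, one_smul,
    pow_zero, pow_one, ← sub_sub] at h2
  have := Submodule.sub_mem _ h1 h2
  rwa [sub_sub_cancel] at this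

end Realization

end KM

end

/-! ### The main theorem -/

theorem mainTheorem6 {ℓ : ℕ} (A : Matrix (Fin ℓ) (Fin ℓ) ℤ) (hA : KM.IsGeneralizedCartan A)
    (hsymm : KM.IsSymmetrizable A)
    {𝔥 : Type*} [AddCommGroup 𝔥] [Module ℂ 𝔥] (R : KM.Realization A 𝔥)
    (P : AddSubgroup (Module.Dual ℂ 𝔥)) (hP : R.IsRestrictedWeightLattice P)
    (V : Type*) [AddCommGroup V] [Module ℂ V] [LieRingModule R.KacMoody V]
    [LieModule ℂ R.KacMoody V] (hV : R.IsWeightModule V) (hwts : R.wts V ⊆ P)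
    (f : P →+ ℤ) (hf : R.IsStandardGrading V f)
    (n m : ℕ) (hn : 1 ≤ n) (hm : 1 ≤ m) :
    -- `Û⁺_{V,n} = exp(ρ(n̂⁺_n))`
    (R.UHat f V n hn = Set.range fun x : R.nHat f n => R.expRho f V (R.incl f n hn x)) ∧
    -- `exp(ρ(x)) Û⁺_{V,n+1} = exp(ρ(x + n̂⁺_{n+1}))`
    (∀ x : R.gDeg f n,
      KM.lcoset (R.expRho f V (R.homog f n hn x)) (R.UHat f V (n + 1) (by omega)) =
        Set.range fun z : R.nHat f (n + 1 : ℕ) =>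
          R.expRho f V (R.homog f n hn x + R.incl f (n + 1) (by omega) z)) ∧
    -- `exp(ρ(x + y)) Û⁺_{V,n+1} = exp(ρ(x)) exp(ρ(y)) Û⁺_{V,n+1}`
    (∀ x y : R.gDeg f n,
      KM.lcoset (R.expRho f V (R.homog f n hn (x + y))) (R.UHat f V (n + 1) (by omega)) =
        KM.lcoset (R.expRho f V (R.homog f n hn x) * R.expRho f V (R.homog f n hn y))
          (R.UHat f V (n + 1) (by omega))) ∧
    -- `exp(ρ([x, y])) Û⁺_{V,n+m+1} = (exp(ρ(x)), exp(ρ(y))) Û⁺_{V,n+m+1}`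
    (∀ (x : R.gDeg f n) (y : R.gDeg f m),
      KM.lcoset
          (R.expRho f V (R.homog f (n + m) (by omega)
            ⟨⁅(x : R.KacMoody), (y : R.KacMoody)⁆,
              R.lie_mem_gDeg f (Nat.cast_add n m).symm x.2 y.2⟩))
          (R.UHat f V (n + m + 1) (by omega)) =
        KM.lcoset (R.expRho f V (R.homog f n hn x) * R.expRho f V (R.homog f m hm y) *
            (R.expRho f V (R.homog f n hn x))⁻¹ * (R.expRho f V (R.homog f m hm y))⁻¹)
          (R.UHat f V (n + m + 1) (by omega))) ∧
    -- `Û⁺_{V,n+1} ⊴ Û⁺_{V,n}` are groups and `exp ∘ ρ` induces a surjective homomorphism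
    -- `n̂⁺_n / n̂⁺_{n+1} → Û⁺_{V,n} / Û⁺_{V,n+1}`, an isomorphism if `V` is faithful
    (∃ G K : Subgroup (LinearMap.GeneralLinearGroup ℂ (R.vHat f V)),
      (G : Set (LinearMap.GeneralLinearGroup ℂ (R.vHat f V))) = R.UHat f V n hn ∧
      (K : Set (LinearMap.GeneralLinearGroup ℂ (R.vHat f V))) =
        R.UHat f V (n + 1) (by omega) ∧
      K ≤ G ∧
      ∃ _ : (K.subgroupOf G).Normal,
      ∃ φ : Multiplicative (R.nHat f n ⧸ R.nHatSucc f n) →* G ⧸ K.subgroupOf G,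
        (∀ (x : R.nHat f n) (g : G),
          (g : LinearMap.GeneralLinearGroup ℂ (R.vHat f V)) =
              R.expRho f V (R.incl f n hn x) →
            φ (Multiplicative.ofAdd (QuotientAddGroup.mk x)) = QuotientGroup.mk g) ∧
        Function.Surjective φ ∧
        (LieModule.IsFaithful ℂ R.KacMoody V → Function.Bijective φ)) := by
  have hn' : (1 : ℤ) ≤ n := by omega
  have hG := R.UHat_eq_expGroup V n hn (f := f)
  have hK := R.UHat_succ_eq_expGroup V n hn (f := f)
  refine ⟨?_, fun x => ?_, fun x y => ?_, fun x y => ?_, ?_⟩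
  · rw [hG]
    ext g
    exact R.mem_expGroup_iff_exists_incl V n hn
  · rw [hK]
    have hx := R.homog_mem f n hn x
    ext g
    constructor
    · rintro ⟨u, ⟨w, hw, rfl⟩, rfl⟩
      obtain ⟨z, -, hz, heq⟩ := R.expRho_mul_expRho V hn' hx (KM.tail_mono (by omega) hw)
      have hz' : (z : R.gHat f) - (R.homog f n hn x : R.gHat f) ∈ R.nHat f (n + 1 : ℕ) := by
        have := Submodule.add_mem _ hz hw
        rwa [sub_add_eq_sub_sub, sub_add_cancel] at this
      refine ⟨⟨_, hz'⟩, ?_⟩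
      rw [heq]
      exact congrArg _ (Subtype.ext (add_sub_cancel _ _))
    · rintro ⟨z, rfl⟩
      have hz : (z : R.gHat f) ∈ R.nHat f (n + 1) := z.2
      refine ⟨_, R.expRho_inv_mul_mem V hn' hx
        (y := R.homog f n hn x + R.incl f (n + 1) (by omega) z)
        (Submodule.add_mem _ hx (KM.tail_mono (by omega) hz)) ?_, (mul_inv_cancel_left _ _).symm⟩
      have := Submodule.neg_mem _ hz
      rwa [← sub_add_cancel_left (R.homog f n hn x : R.gHat f) (z : R.gHat f)] at this
  · rw [hK]
    have hx := R.homog_mem f n hn x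
    have hy := R.homog_mem f n hn y
    obtain ⟨z, hz, hz', heq⟩ := R.expRho_mul_expRho V hn' hx hy
    rw [heq]
    refine KM.lcoset_eq_lcoset _ (R.expRho_inv_mul_mem V hn' (R.homog_mem f n hn (x + y)) hz ?_)
    have hxy : (R.homog f n hn (x + y) : R.gHat f)
        = (R.homog f n hn x : R.gHat f) + (R.homog f n hn y : R.gHat f) :=
      Subtype.ext (Pi.single_add _ _ _)
    rw [hxy, ← neg_sub]
    exact Submodule.neg_mem _ hz'
  · rw [R.UHat_succ_eq_expGroup V (n + m) (by omega)]
    obtain ⟨w, hw, hw', heq⟩ := R.commutator_expRho V hn' (by omega : (1 : ℤ) ≤ m) x y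
      (R.coe_homog n hn x) (R.coe_homog m hm y)
    rw [heq]
    refine KM.lcoset_eq_lcoset _ (R.expRho_inv_mul_mem V (by push_cast; omega)
      (R.homog_mem f (n + m) _ _) (by push_cast; exact hw) ?_)
    rw [R.coe_homog n hn x, R.coe_homog m hm y, R.adHat_single_single] at hw'
    rw [R.coe_homog, ← neg_sub]
    refine Submodule.neg_mem _ ?_
    push_cast
    exact hw'
  · let G := R.expGroup V n hn' (f := f)
    let K := R.expGroup V (n + 1) (by omega) (f := f)
    have hmem : ∀ x : R.nHat f n, R.expRho f V (R.incl f n hn x) ∈ G := fun x => ⟨_, x.2, rfl⟩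
    have hKG : K ≤ G := R.expGroup_mono hn' (by omega)
    have hnormal : (K.subgroupOf G).Normal := by
      refine ⟨?_⟩
      rintro g hg ⟨_, x, -, rfl⟩
      exact R.expRho_conj_mem V (by omega) x hg
    -- Additivity holds modulo K because exp(ρ(x)) exp(ρ(y)) = exp(ρ(z)) with z congruent to x + y
    -- modulo n̂⁺_{n+1}.
    let ψ : R.nHat f n →+ Additive (G ⧸ K.subgroupOf G) := AddMonoidHom.mk'
      (fun x => Additive.ofMul (QuotientGroup.mk ⟨_, hmem x⟩)) fun x y => by
        obtain ⟨z, hz, hz', heq⟩ := R.expRho_mul_expRho V hn' x.2 y.2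
          (x := R.incl f n hn x) (y := R.incl f n hn y)
        refine congrArg Additive.ofMul (QuotientGroup.eq.mpr ?_)
        have h := R.expRho_inv_mul_mem V hn' (x := R.incl f n hn (x + y)) (y := z) (x + y).2 hz (by
          have := Submodule.neg_mem _ hz'
          rwa [neg_sub] at this)
        rwa [← heq] at h
    have hψ : ∀ x ∈ R.nHatSucc f n, ψ x = 0 := fun x hx =>
      congrArg Additive.ofMul ((QuotientGroup.eq_one_iff _).mpr
        (show R.expRho f V (R.incl f n hn x) ∈ K from ⟨R.incl f n hn x, hx, rfl⟩))
    let φ := AddMonoidHom.toMultiplicativeLeft (QuotientAddGroup.lift _ ψ hψ)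
    have hφ : ∀ x : R.nHat f n, φ (Multiplicative.ofAdd (QuotientAddGroup.mk x))
        = QuotientGroup.mk ⟨_, hmem x⟩ := fun x => rfl
    have hsurj : Function.Surjective φ := by
      intro q
      obtain ⟨⟨g, hg⟩, rfl⟩ := QuotientGroup.mk_surjective q
      obtain ⟨x, rfl⟩ := (R.mem_expGroup_iff_exists_incl V n hn).mp hg
      exact ⟨_, hφ x⟩
    refine ⟨G, K, hG.symm, hK.symm, hKG, hnormal, φ, fun x g hg => ?_, hsurj, fun hfaith => ⟨?_, hsurj⟩⟩
    · rw [hφ]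
      exact congrArg _ (Subtype.ext hg.symm)
    · rw [injective_iff_map_eq_one]
      intro q
      induction q using Multiplicative.rec with | _ q
      obtain ⟨x, rfl⟩ := QuotientAddGroup.mk_surjective q
      intro hx
      rw [hφ, QuotientGroup.eq_one_iff] at hx
      exact congrArg Multiplicative.ofAdd ((QuotientAddGroup.eq_zero_iff x).mpr
        (R.mem_nHat_of_expRho_mem hV hwts hn' x.2 hx))
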